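/- **Setting.** Let $(A(i),C(i))$, $i=1,\dots,l$ ($l\ge 1$), be finitely many modes with $A(i)\in\mathbb R^{n\times n}$, $C(i)\in\mathbb R^{m\times n}$. Consider the switched system $$x_{k+1}=A_kx_k+w_k,\qquad y_k=C_kx_k+v_k,\qquad (A_k,C_k)=(A(i_k),C(i_k)),\quad k\ge 0,$$ with $x_0\sim\mathcal N(\hat x_{0|-1},P_{0|-1})$, $w_k\sim\mathcal N(0,Q)$, $v_k\sim\mathcal N(0,R)$, where $Q,P_{0|-1}\succeq 0$ and $R\succ 0$. The mode sequence $(i_k)$ is known to the estimator and may change only every $\kappa$ time steps, i.e. it is constant on each block $\{j\kappa,\dots,(j+1)\kappa-1\}$, where $\kappa\ge 2n$ is fixed. Let $C^s(i)$ be the $s$th row of $C(i)$, let $\mathcal O^s_{n,i}$ be the matrix with rows $C^s(i)A(i)^t$, $0\le t<n$, and assume that every pair $(A(i),C(i))$ is observable and that, for each sensor $s$, $\mathrm{NS}(\mathcal O^s_{n,1})=\dots=\mathrm{NS}(\mathcal O^s_{n,l})$, where $\mathrm{NS}$ denotes the null space. For each $s$ let $\mathcal T_s=[\mathcal T_s^{uo}\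 \mathcal T_s^{o}]$ be an invertible matrix such that the columns of $\mathcal T_s^{uo}$ form a basis of $\mathrm{NS}(\mathcal O^s_{n,1})$; let $S_s$ consist of the last rows of $\mathcal T_s^{-1}$, so that $S_s\mathcal T_s^{uo}=0$ and $S_s\mathcal T_s^{o}=I$, and put $\zeta_{k,s}=S_sx_k$, $A_{k,s}=S_sA_k\mathcal T_s^o$, $C_{k,s}=C_k^s\mathcal T_s^o$, $Q_{s_1,s_2}=S_{s_1}QS_{s_2}^T$. **Estimator.** Each sensor $s$ runs the filter $$\hat\zeta_{k+1|k,s}=A_{k,s}\hat\zeta_{k|k,s},\qquad \hat\zeta_{k|k,s}=(I-K_{k,s}C_{k,s})\hat\zeta_{k|k-1,s}+K_{k,s}y_k^s,$$ $$K_{k,s}=P^{s,s}_{k|k-1}C_{k,s}^T(C_{k,s}P^{s,s}_{k|k-1}C_{k,s}^T+R_{s,s})^{-1},$$ $$P^{s_1,s_2}_{k+1|k}=A_{k,s_1}P^{s_1,s_2}_{k|k}A_{k,s_2}^T+Q_{s_1,s_2},$$ $$P^{s_1,s_2}_{k|k}=(I-K_{k,s_1}C_{k,s_1})P^{s_1,s_2}_{k|k-1}(I-K_{k,s_2}C_{k,s_2})^T+K_{k,s_1}R_{s_1,s_2}K_{k,s_2}^T,$$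 started from $\hat\zeta_{0|-1,s}=S_s\hat x_{0|-1}$ and $P^{s_1,s_2}_{0|-1}=S_{s_1}P_{0|-1}S_{s_2}^T$. Fix $\sigma>0$ and let $\alpha_{k,s}\sim\mathcal N(0,\sigma I)$ in $\mathbb R^n$; the vectors $x_0$, $w_k$, $v_k$, $\alpha_{k,s}$ (all $k,s$) are mutually independent. Let $\hat{\mathbf y}_k$ have blocks $\mathcal T^o_s\hat\zeta_{k|k,s}+\alpha_{k,s}$, $s=1,\dots,m$, let $\Upsilon_k$ have blocks $\mathcal T_i^oP^{i,j}_{k|k}\mathcal T_j^{oT}+\delta_{ij}\sigma I$, and let $$W=\begin{bmatrix}-\mathcal T_1^{uo}&\cdots&0&I\\ \vdots&\ddots&\vdots&\vdots\\ 0&\cdots&-\mathcal T_m^{uo}&I\end{bmatrix},\qquad \hat{\mathbf x}_k=(W^T\Upsilon_k^{-1}W)^{-1}W^T\Upsilon_k^{-1}\hat{\mathbf y}_k .$$ The estimate $\hat x_k^*$ of $x_k$ consists of the last $n$ entries of $\hat{\mathbf x}_k$. **Theorem.** The estimator $\hat x_k^*$ has bounded error covariance. Precisely, for all $k$ the innovation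 variances $C_{k,s}P^{s,s}_{k|k-1}C_{k,s}^T+R_{s,s}$ are positive, $\Upsilon_k\succ 0$, and $W^T\Upsilon_k^{-1}W$ is invertible; with $e_{k|k-1,s}=\zeta_{k,s}-\hat\zeta_{k|k-1,s}$ and $e_{k|k,s}=\zeta_{k,s}-\hat\zeta_{k|k,s}$ one has $P^{s_1,s_2}_{k|k-1}=\mathbb E[e_{k|k-1,s_1}e_{k|k-1,s_2}^T]$ and $P^{s_1,s_2}_{k|k}=\mathbb E[e_{k|k,s_1}e_{k|k,s_2}^T]$; the error $e_k^*=x_k-\hat x_k^*$ is square integrable with mean zero; and there is a constant $M$, independent of $k$ and of the mode sequence, such that all entries of $\mathrm{Cov}(e_k^*)$ are at most $M$ in absolute value for every $k\ge 0$. -/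

import Mathlib

open Matrix MeasureTheory ProbabilityTheory

noncomputable section

/-- The `n`-step observability matrix of the pair `(A, C)`: the rows of `C * A ^ t`,
`t = 0, …, n - 1`, stacked on top of each other. -/
def obsMatrix {n : ℕ} {ι : Type*} [Fintype ι]
    (A : Matrix (Fin n) (Fin n) ℝ) (C : Matrix ι (Fin n) ℝ) : Matrix (Fin n × ι) (Fin n) ℝ :=
  Matrix.of fun ti => (C * A ^ (ti.1 : ℕ)) ti.2

/-- The null space of the observability matrix (the unobservable subspace). -/
def unobservable {n : ℕ} {ι : Type*} [Fintype ι]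
    (A : Matrix (Fin n) (Fin n) ℝ) (C : Matrix ι (Fin n) ℝ) : Submodule ℝ (Fin n → ℝ) :=
  LinearMap.ker (obsMatrix A C).mulVecLin

/-- The pair `(A, C)` is observable: the observability matrix has trivial null space. -/
def IsObservable {n : ℕ} {ι : Type*} [Fintype ι]
    (A : Matrix (Fin n) (Fin n) ℝ) (C : Matrix ι (Fin n) ℝ) : Prop :=
  unobservable A C = ⊥

/-- A state transformation adapted to a subspace `N`: an invertible matrix `T = [Tuo To]` such that
the columns of `Tuo` form a basis of `N`. (The columns of `Tuo` are linearly independent because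
`T` is invertible.) -/
structure AdaptedTransform {n : ℕ} (N : Submodule ℝ (Fin n → ℝ)) where
  /-- dimension of the unobservable part -/
  dimUo : ℕ
  /-- dimension of the observable part -/
  dimO : ℕ
  /-- the columns spanning `N` -/
  Tuo : Matrix (Fin n) (Fin dimUo) ℝ
  /-- the remaining columns -/
  To : Matrix (Fin n) (Fin dimO) ℝ
  /-- the inverse of `T` -/
  Tinv : Matrix (Fin dimUo ⊕ Fin dimO) (Fin n) ℝ
  mul_inv : Matrix.fromCols Tuo To * Tinv = 1
  inv_mul : Tinv * Matrix.fromCols Tuo To = 1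
  range_Tuo : LinearMap.range Tuo.mulVecLin = N

/-- The rows of the inverse of `T` giving the observable coordinates: if `x = Tuo ζuo + To ζ`, then
`ζ = So x`. -/
def AdaptedTransform.So {n : ℕ} {N : Submodule ℝ (Fin n → ℝ)} (D : AdaptedTransform N) :
    Matrix (Fin D.dimO) (Fin n) ℝ :=
  D.Tinv.toRows₂

/-- The data of a switched linear system with `l` modes `(A i, C i)`, state space `ℝⁿ` and `m`
scalar sensors, process noise covariance `Q`, sensor noise covariance `R`, and mean `xhat0` and
covariance `P0` of the initial state. -/
structure SwitchedSystem (l m n : ℕ) where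
  A : Fin l → Matrix (Fin n) (Fin n) ℝ
  C : Fin l → Matrix (Fin m) (Fin n) ℝ
  Q : Matrix (Fin n) (Fin n) ℝ
  R : Matrix (Fin m) (Fin m) ℝ
  xhat0 : EuclideanSpace ℝ (Fin n)
  P0 : Matrix (Fin n) (Fin n) ℝ

namespace SwitchedSystem

variable {l m n : ℕ} (S : SwitchedSystem l m n)

/-- The subspace of the state space that is unobservable to the single sensor `s` in mode `i`. -/
def sensorUnobservable (i : Fin l) (s : Fin m) : Submodule ℝ (Fin n → ℝ) :=
  unobservable (S.A i) (Matrix.replicateRow Unit (S.C i s))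

/-- A choice of state transformation for each sensor, adapted to what the sensor cannot observe in
the first mode. -/
abbrev Transforms [NeZero l] : Type :=
  ∀ s : Fin m, AdaptedTransform (S.sensorUnobservable 0 s)

/-- The state trajectory `x_{k+1} = A_k x_k + w_k`. -/
def state (mode : ℕ → Fin l) (x0 : EuclideanSpace ℝ (Fin n))
    (w : ℕ → EuclideanSpace ℝ (Fin n)) : ℕ → Fin n → ℝ
  | 0 => x0.ofLp
  | k + 1 => S.A (mode k) *ᵥ state mode x0 w k + (w k).ofLp

/-- The measurements `y_k = C_k x_k + v_k`. -/
def output (mode : ℕ → Fin l) (x0 : EuclideanSpace ℝ (Fin n))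
    (w : ℕ → EuclideanSpace ℝ (Fin n)) (v : ℕ → EuclideanSpace ℝ (Fin m)) (k : ℕ) : Fin m → ℝ :=
  S.C (mode k) *ᵥ S.state mode x0 w k + (v k).ofLp

section Estimator

variable [NeZero l] {S} (T : S.Transforms)

/-- The dynamics of the part of the state observed by sensor `s` in mode `i`. -/
def subA (i : Fin l) (s : Fin m) : Matrix (Fin (T s).dimO) (Fin (T s).dimO) ℝ :=
  (T s).So * S.A i * (T s).To

/-- The (single) row of the output matrix of the subsystem observed by sensor `s` in mode `i`. -/
def subC (i : Fin l) (s : Fin m) : Fin (T s).dimO → ℝ :=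
  S.C i s ᵥ* (T s).To

/-- The variance `C P Cᵀ + R_{s,s}` of the innovation of the filter of sensor `s`. -/
def innovationVar (i : Fin l) (s : Fin m) (P : Matrix (Fin (T s).dimO) (Fin (T s).dimO) ℝ) : ℝ :=
  subC T i s ⬝ᵥ (P *ᵥ subC T i s) + S.R s s

/-- The Kalman gain `P Cᵀ (C P Cᵀ + R_{s,s})⁻¹` (a single column). -/
def kalmanGain (i : Fin l) (s : Fin m) (P : Matrix (Fin (T s).dimO) (Fin (T s).dimO) ℝ) :
    Fin (T s).dimO → ℝ :=
  (innovationVar T i s P)⁻¹ • (P *ᵥ subC T i s)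

/-- The matrix `I - K C`. -/
def updateMatrix (i : Fin l) (s : Fin m) (P : Matrix (Fin (T s).dimO) (Fin (T s).dimO) ℝ) :
    Matrix (Fin (T s).dimO) (Fin (T s).dimO) ℝ :=
  1 - Matrix.vecMulVec (kalmanGain T i s P) (subC T i s)

/-- The measurement update of the family of cross-covariances `P^{s₁,s₂}`. -/
def covUpdate (i : Fin l) (P : ∀ s₁ s₂ : Fin m, Matrix (Fin (T s₁).dimO) (Fin (T s₂).dimO) ℝ)
    (s₁ s₂ : Fin m) : Matrix (Fin (T s₁).dimO) (Fin (T s₂).dimO) ℝ :=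
  updateMatrix T i s₁ (P s₁ s₁) * P s₁ s₂ * (updateMatrix T i s₂ (P s₂ s₂))ᵀ +
    S.R s₁ s₂ • Matrix.vecMulVec (kalmanGain T i s₁ (P s₁ s₁)) (kalmanGain T i s₂ (P s₂ s₂))

variable (mode : ℕ → Fin l)

/-- The a priori error covariances `P_{k|k-1}^{s₁,s₂}`. -/
def priorCov : ℕ → ∀ s₁ s₂ : Fin m, Matrix (Fin (T s₁).dimO) (Fin (T s₂).dimO) ℝ
  | 0 => fun s₁ s₂ => (T s₁).So * S.P0 * (T s₂).Soᵀ
  | k + 1 => fun s₁ s₂ =>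
      subA T (mode k) s₁ * covUpdate T (mode k) (priorCov k) s₁ s₂ * (subA T (mode k) s₂)ᵀ +
        (T s₁).So * S.Q * (T s₂).Soᵀ

/-- The a posteriori error covariances `P_{k|k}^{s₁,s₂}`. -/
def postCov (k : ℕ) (s₁ s₂ : Fin m) : Matrix (Fin (T s₁).dimO) (Fin (T s₂).dimO) ℝ :=
  covUpdate T (mode k) (priorCov T mode k) s₁ s₂

/-- The update `(I - K_{k,s} C_{k,s}) ζ + K_{k,s} y` of an a priori estimate `ζ` by a measurement
`y` of sensor `s` at time `k`. -/
def estUpdate (k : ℕ) (s : Fin m) (ζ : Fin (T s).dimO → ℝ) (y : ℝ) : Fin (T s).dimO → ℝ :=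
  updateMatrix T (mode k) s (priorCov T mode k s s) *ᵥ ζ +
    y • kalmanGain T (mode k) s (priorCov T mode k s s)

/-- The a priori estimates `ζ̂_{k|k-1,s}` computed from the measurements `y`. -/
def priorEst (y : ℕ → Fin m → ℝ) : ℕ → ∀ s : Fin m, Fin (T s).dimO → ℝ
  | 0 => fun s => (T s).So *ᵥ S.xhat0.ofLp
  | k + 1 => fun s => subA T (mode k) s *ᵥ estUpdate T mode k s (priorEst y k s) (y k s)

/-- The a posteriori estimates `ζ̂_{k|k,s}` computed from the measurements `y`. -/
def postEst (y : ℕ → Fin m → ℝ) (k : ℕ) (s : Fin m) : Fin (T s).dimO → ℝ :=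
  estUpdate T mode k s (priorEst T mode y k s) (y k s)

/-- The matrix `W`, whose block row `s` is `[0 … 0 -Tuo_s 0 … 0 I]`. -/
def fusionW : Matrix (Fin m × Fin n) ((Σ s : Fin m, Fin (T s).dimUo) ⊕ Fin n) ℝ :=
  Matrix.fromCols
    (Matrix.of fun sa tj => if sa.1 = tj.1 then -(T tj.1).Tuo sa.2 tj.2 else 0)
    (Matrix.of fun sa b => (1 : Matrix (Fin n) (Fin n) ℝ) sa.2 b)

/-- The matrix `Υ_k`, whose block `(s₁, s₂)` is `To_{s₁} P_{k|k}^{s₁,s₂} To_{s₂}ᵀ + δ_{s₁ s₂} σ I`. -/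
def fusionCov (σ : ℝ) (k : ℕ) : Matrix (Fin m × Fin n) (Fin m × Fin n) ℝ :=
  Matrix.of (fun sa tb => ((T sa.1).To * postCov T mode k sa.1 tb.1 * (T tb.1).Toᵀ) sa.2 tb.2) +
    σ • 1

/-- The stacked sensor estimates, with blocks `To_s ζ̂_{k|k,s} + α_{k,s}`. -/
def stackedEst (y : ℕ → Fin m → ℝ) (α : ℕ → Fin m → EuclideanSpace ℝ (Fin n)) (k : ℕ) :
    Fin m × Fin n → ℝ :=
  fun sa => ((T sa.1).To *ᵥ postEst T mode y k sa.1) sa.2 + α k sa.1 sa.2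

/-- The weighted least squares estimate `(Wᵀ Υ⁻¹ W)⁻¹ Wᵀ Υ⁻¹ ŷ_k`. -/
def fusedFull (σ : ℝ) (y : ℕ → Fin m → ℝ) (α : ℕ → Fin m → EuclideanSpace ℝ (Fin n)) (k : ℕ) :
    (Σ s : Fin m, Fin (T s).dimUo) ⊕ Fin n → ℝ :=
  (((fusionW T)ᵀ * (fusionCov T mode σ k)⁻¹ * fusionW T)⁻¹ *
    (fusionW T)ᵀ * (fusionCov T mode σ k)⁻¹) *ᵥ stackedEst T mode y α k

/-- The fused estimate of the state `x_k`: the last `n` entries of the least squares estimate. -/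
def fusedEst (σ : ℝ) (y : ℕ → Fin m → ℝ) (α : ℕ → Fin m → EuclideanSpace ℝ (Fin n)) (k : ℕ) :
    Fin n → ℝ :=
  fun a => fusedFull T mode σ y α k (Sum.inr a)

end Estimator

end SwitchedSystem

/-- Index set for all sources of randomness: the initial state, the process noise `w_k`, the sensor
noise `v_k` and the artificial noise `α_{k,s}`. -/
inductive NoiseIndex (m : ℕ) where
  | init : NoiseIndex m
  | process (k : ℕ) : NoiseIndex m
  | sensor (k : ℕ) : NoiseIndex m
  | artificial (k : ℕ) (s : Fin m) : NoiseIndex m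

/-- The dimension of each random vector. -/
def NoiseIndex.dim {m : ℕ} (n : ℕ) : NoiseIndex m → ℕ
  | .init => n
  | .process _ => n
  | .sensor _ => m
  | .artificial _ _ => n

/-- All random vectors as a single family. -/
def noiseFamily {m n : ℕ} {Ω : Type*} (x0 : Ω → EuclideanSpace ℝ (Fin n))
    (w : ℕ → Ω → EuclideanSpace ℝ (Fin n)) (v : ℕ → Ω → EuclideanSpace ℝ (Fin m))
    (α : ℕ → Fin m → Ω → EuclideanSpace ℝ (Fin n)) :
    ∀ i : NoiseIndex m, Ω → EuclideanSpace ℝ (Fin (i.dim n))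
  | .init => x0
  | .process k => w k
  | .sensor k => v k
  | .artificial k s => α k s

/-- The probabilistic assumptions: `x_0 ∼ N(xhat0, P0)`, `w_k ∼ N(0, Q)`, `v_k ∼ N(0, R)`,
`α_{k,s} ∼ N(0, σ I)`, all of them mutually independent. -/
structure SwitchedSystem.IsNoise {l m n : ℕ} (S : SwitchedSystem l m n) (σ : ℝ)
    {Ω : Type*} [MeasurableSpace Ω] (μ : Measure Ω) (x0 : Ω → EuclideanSpace ℝ (Fin n))
    (w : ℕ → Ω → EuclideanSpace ℝ (Fin n)) (v : ℕ → Ω → EuclideanSpace ℝ (Fin m))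
    (α : ℕ → Fin m → Ω → EuclideanSpace ℝ (Fin n)) : Prop where
  init : HasLaw x0 (multivariateGaussian S.xhat0 S.P0) μ
  process : ∀ k, HasLaw (w k) (multivariateGaussian 0 S.Q) μ
  sensor : ∀ k, HasLaw (v k) (multivariateGaussian 0 S.R) μ
  artificial : ∀ k s, HasLaw (α k s) (multivariateGaussian 0 (σ • 1)) μ
  indep : iIndepFun (noiseFamily x0 w v α) μ

namespace SwitchedSystem

variable {l m n : ℕ} [NeZero l] {S : SwitchedSystem l m n} (T : S.Transforms) (mode : ℕ → Fin l)
  {Ω : Type*} (x0 : Ω → EuclideanSpace ℝ (Fin n)) (w : ℕ → Ω → EuclideanSpace ℝ (Fin n))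
  (v : ℕ → Ω → EuclideanSpace ℝ (Fin m))

/-- The a priori error `e_{k|k-1,s} = ζ_{k,s} - ζ̂_{k|k-1,s}` of the filter of sensor `s`. -/
def priorError (k : ℕ) (s : Fin m) (ω : Ω) : Fin (T s).dimO → ℝ :=
  (T s).So *ᵥ S.state mode (x0 ω) (fun j => w j ω) k -
    priorEst T mode (S.output mode (x0 ω) (fun j => w j ω) (fun j => v j ω)) k s

/-- The a posteriori error `e_{k|k,s} = ζ_{k,s} - ζ̂_{k|k,s}` of the filter of sensor `s`. -/
def postError (k : ℕ) (s : Fin m) (ω : Ω) : Fin (T s).dimO → ℝ :=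
  (T s).So *ᵥ S.state mode (x0 ω) (fun j => w j ω) k -
    postEst T mode (S.output mode (x0 ω) (fun j => w j ω) (fun j => v j ω)) k s

/-- The error `x_k - x̂*_k` of the fused estimate of the state. -/
def fusedError (σ : ℝ) (α : ℕ → Fin m → Ω → EuclideanSpace ℝ (Fin n)) (k : ℕ) (ω : Ω) :
    Fin n → ℝ :=
  S.state mode (x0 ω) (fun j => w j ω) k -
    fusedEst T mode σ (S.output mode (x0 ω) (fun j => w j ω) (fun j => v j ω))
      (fun j s => α j s ω) k

end SwitchedSystem

end

/-! The unobservable subspace of a sensor is the same in all modes and invariant under every `A i`,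
so the reduced coordinates ζ = So x obey closed switched dynamics that are observable in every mode
(`subA_mul_So`, `sub_observable`). The filter errors then follow linear recursions driven by fresh
independent noise. Hence the propagated matrices are true error covariances, in particular positive
semidefinite (`secondMoment_priorError`).

Boundedness is a comparison argument. The Kalman gain minimizes the error variance in every
direction, so each Riccati step is dominated by the linear step of an observer with any other gain
(`joseph_quadForm_kalmanGain_le`). An observable single-output pair has a deadbeat gain, with
nilpotent error dynamics (`exists_deadbeat_gain`). With this gain an observer forgets the past
within `dimO` ≤ n ≤ κ steps, so each block of constant mode is long enough for a reset. What remains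
takes finitely many values, which depend on the current mode, the previous mode and the position in
the block (`exists_priorCov_le`).

Fusion is least squares with injective `fusionW` (`fusionW_injective`) and noise covariance Υ_k, now
uniformly bounded. By Gauss–Markov its error variance is at most that of unweighted least squares,
whose gain depends neither on k nor on the mode sequence (`leastSquaresGain_variance_le`). -/

noncomputable section

/-! ### Deadbeat gains for single-output observable pairs. -/

/-- By the Cayley–Hamilton theorem, `n` vanishing outputs of a free response force all outputs to
vanish. -/
lemma dotProduct_pow_mulVec_eq_zero {n : ℕ} {A : Matrix (Fin n) (Fin n) ℝ} {c x : Fin n → ℝ}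
    (h : ∀ t < n, c ⬝ᵥ (A ^ t *ᵥ x) = 0) (t : ℕ) : c ⬝ᵥ (A ^ t *ᵥ x) = 0 := by
  rcases Nat.eq_zero_or_pos n with rfl | hn
  · simp [dotProduct]
  have : Nonempty (Fin n) := ⟨⟨0, hn⟩⟩
  have hdeg : (Polynomial.X ^ t %ₘ A.charpoly).natDegree < n := by
    have := Polynomial.natDegree_modByMonic_lt (Polynomial.X ^ t : Polynomial ℝ)
      A.charpoly_monic (fun h1 => by
        have := A.charpoly_natDegree_eq_dim
        rw [h1] at this
        simp at this
        omega)
    rwa [A.charpoly_natDegree_eq_dim, Fintype.card_fin] at this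
  rw [Matrix.pow_eq_aeval_mod_charpoly, Polynomial.aeval_eq_sum_range' hdeg, Matrix.sum_mulVec,
    dotProduct_sum]
  refine Finset.sum_eq_zero fun i hi => ?_
  rw [Matrix.smul_mulVec, dotProduct_smul, h i (Finset.mem_range.1 hi), smul_zero]

/-- A single-output observable pair admits a deadbeat gain (in filtered form). -/
lemma exists_deadbeat_gain {d : ℕ} (A : Matrix (Fin d) (Fin d) ℝ) (c : Fin d → ℝ)
    (h : ∀ x, (∀ t, c ⬝ᵥ (A ^ t *ᵥ x) = 0) → x = 0) :
    ∃ L : Fin d → ℝ, (A * (1 - vecMulVec L c)) ^ d = 0 := by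
  rcases Nat.eq_zero_or_pos d with rfl | hd
  · exact ⟨0, Subsingleton.elim _ _⟩
  let O : Matrix (Fin d) (Fin d) ℝ := Matrix.of fun t => c ᵥ* A ^ (t : ℕ)
  have hO (x : Fin d → ℝ) (t : Fin d) : (O *ᵥ x) t = c ⬝ᵥ (A ^ (t : ℕ) *ᵥ x) := by
    rw [dotProduct_mulVec]; rfl
  have hinj : Function.Injective O.mulVecLin := by
    rw [← LinearMap.ker_eq_bot, LinearMap.ker_eq_bot']
    intro x hx
    refine h x (dotProduct_pow_mulVec_eq_zero fun t ht => ?_)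
    rw [← hO x ⟨t, ht⟩]
    exact congrFun hx _
  -- Ackermann's construction: the free response from v stays invisible until time d - 1, where the
  -- output is 1. With L = A^(d-1) v, correction by L c does nothing before that time and then
  -- removes the state exactly.
  obtain ⟨v, hv⟩ := (LinearMap.injective_iff_surjective.1 hinj) (Pi.single ⟨d - 1, by omega⟩ 1)
  have hcv (t : ℕ) (ht : t < d) : c ⬝ᵥ (A ^ t *ᵥ v) = if t = d - 1 then 1 else 0 := by
    rw [← hO v ⟨t, ht⟩]
    change O.mulVecLin v _ = _
    rw [hv]
    simp [Pi.single_apply]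
  set L := A ^ (d - 1) *ᵥ v with hL
  refine ⟨L, ?_⟩
  set F := A * (1 - vecMulVec L c) with hF
  have hFx (x : Fin d → ℝ) : F *ᵥ x = A *ᵥ (x - (c ⬝ᵥ x) • L) := by
    rw [hF, ← mulVec_mulVec, sub_mulVec, one_mulVec]
    congr 2
    ext a
    simp [mulVec, vecMulVec_apply, dotProduct, Finset.mul_sum, mul_assoc, mul_comm, mul_left_comm]
  have hFpow (t : ℕ) (ht : t < d) : F ^ t *ᵥ v = A ^ t *ᵥ v := by
    induction t with
    | zero => simp
    | succ t ih =>
      rw [pow_succ', ← mulVec_mulVec, ih (by omega), hFx, hcv t (by omega), if_neg (by omega),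
        zero_smul, sub_zero, pow_succ', ← mulVec_mulVec]
  have hFd : F ^ d *ᵥ v = 0 := by
    obtain ⟨e, rfl⟩ : ∃ e, d = e + 1 := ⟨d - 1, by omega⟩
    rw [pow_succ', ← mulVec_mulVec, hFpow e (by omega), hFx, hcv e (by omega)]
    simp [hL]
  -- The orbit of v is listed backwards, so that O * V is lower triangular with unit diagonal. Thus
  -- v is a cyclic vector, and F ^ d v = 0 forces F ^ d = 0.
  let V : Matrix (Fin d) (Fin d) ℝ := Matrix.of fun a (j : Fin d) => (A ^ (d - 1 - (j : ℕ)) *ᵥ v) a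
  have hOV (s j : Fin d) : (O * V) s j = c ⬝ᵥ (A ^ ((s : ℕ) + (d - 1 - j)) *ᵥ v) := by
    rw [pow_add, ← mulVec_mulVec, ← hO]
    rfl
  have hdet : (O * V).det = 1 := by
    rw [Matrix.det_of_isLowerTriangular]
    · refine Finset.prod_eq_one fun j _ => ?_
      rw [hOV, hcv _ (by omega), if_pos (by omega)]
    · intro s j hsj
      have : s < j := hsj
      rw [hOV, hcv _ (by omega), if_neg (by omega)]
  have hV : IsUnit V := by
    rw [Matrix.isUnit_iff_isUnit_det]
    rw [det_mul] at hdet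
    exact IsUnit.of_mul_eq_one _ (by rwa [mul_comm] at hdet)
  have hFV : F ^ d * V = 0 := by
    ext a j
    change (F ^ d *ᵥ (A ^ (d - 1 - (j : ℕ)) *ᵥ v)) a = 0
    rw [← hFpow _ (by omega), mulVec_mulVec, ← pow_add, add_comm, pow_add, ← mulVec_mulVec, hFd,
      mulVec_zero]
    rfl
  exact hV.mul_left_eq_zero.1 hFV

/-! ### Observable coordinates of a single sensor. -/

namespace AdaptedTransform

variable {n : ℕ} {N : Submodule ℝ (Fin n → ℝ)} (D : AdaptedTransform N)

lemma So_mul_To : D.So * D.To = 1 := by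
  have h := D.inv_mul
  ext a b
  have := congrFun (congrFun h (Sum.inr a)) (Sum.inr b)
  simpa [Matrix.mul_apply, So, Matrix.one_apply] using this

lemma So_mul_Tuo : D.So * D.Tuo = 0 := by
  have h := D.inv_mul
  ext a b
  have := congrFun (congrFun h (Sum.inr a)) (Sum.inl b)
  simpa [Matrix.mul_apply, So, Matrix.one_apply] using this

lemma toRows₁_mul_Tuo : D.Tinv.toRows₁ * D.Tuo = 1 := by
  have h := D.inv_mul
  ext a b
  have := congrFun (congrFun h (Sum.inl a)) (Sum.inl b)
  simpa [Matrix.mul_apply, Matrix.one_apply] using this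

lemma Tuo_mul_add_To_mul : D.Tuo * D.Tinv.toRows₁ + D.To * D.So = 1 := by
  have h := D.mul_inv
  rw [← Matrix.fromRows_toRows D.Tinv, Matrix.fromCols_mul_fromRows] at h
  exact h

lemma Tuo_mulVec_mem (z : Fin D.dimUo → ℝ) : D.Tuo *ᵥ z ∈ N := by
  have := LinearMap.mem_range_self D.Tuo.mulVecLin z
  rwa [D.range_Tuo] at this

lemma So_mulVec_eq_zero {x : Fin n → ℝ} (hx : x ∈ N) : D.So *ᵥ x = 0 := by
  rw [← D.range_Tuo] at hx
  obtain ⟨z, rfl⟩ := hx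
  change D.So *ᵥ (D.Tuo *ᵥ z) = 0
  rw [mulVec_mulVec, So_mul_Tuo, zero_mulVec]

/-- The identity of size `dimO` factors through ℝⁿ, so its rank is at most n. -/
lemma dimO_le : D.dimO ≤ n := by
  have h1 := Matrix.rank_mul_le_left D.So D.To
  rw [So_mul_To, Matrix.rank_one, Fintype.card_fin] at h1
  simpa using h1.trans (Matrix.rank_le_card_width _)

end AdaptedTransform

namespace SwitchedSystem

variable {l m n : ℕ} {S : SwitchedSystem l m n}

/-- Cayley–Hamilton removes the bound t < n; without it, invariance under `S.A i` is a mere shift of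
t. -/
lemma mem_sensorUnobservable_iff {i : Fin l} {s : Fin m} {x : Fin n → ℝ} :
    x ∈ S.sensorUnobservable i s ↔ ∀ t, S.C i s ⬝ᵥ (S.A i ^ t *ᵥ x) = 0 := by
  have key : x ∈ S.sensorUnobservable i s ↔ ∀ t < n, S.C i s ⬝ᵥ (S.A i ^ t *ᵥ x) = 0 := by
    unfold sensorUnobservable unobservable
    rw [LinearMap.mem_ker, mulVecLin_apply, funext_iff]
    have (t : Fin n) (u : Unit) : (obsMatrix (S.A i) (replicateRow Unit (S.C i s)) *ᵥ x) (t, u) =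
        S.C i s ⬝ᵥ (S.A i ^ (t : ℕ) *ᵥ x) := by
      rw [dotProduct_mulVec]; rfl
    constructor
    · intro h t ht
      rw [← this ⟨t, ht⟩ ()]
      exact h _
    · rintro h ⟨t, u⟩
      rw [this]
      exact h t t.2
  rw [key]
  exact ⟨fun h t => dotProduct_pow_mulVec_eq_zero h t, fun h t _ => h t⟩

lemma mulVec_mem_sensorUnobservable {i : Fin l} {s : Fin m} {x : Fin n → ℝ}
    (hx : x ∈ S.sensorUnobservable i s) : S.A i *ᵥ x ∈ S.sensorUnobservable i s := by
  rw [mem_sensorUnobservable_iff] at hx ⊢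
  intro t
  rw [mulVec_mulVec, ← pow_succ]
  exact hx (t + 1)

/-- A state that every sensor fails to observe vanishes. -/
lemma eq_zero_of_forall_mem_sensorUnobservable {i : Fin l} (h : IsObservable (S.A i) (S.C i))
    {x : Fin n → ℝ} (hx : ∀ s, x ∈ S.sensorUnobservable i s) : x = 0 := by
  have : x ∈ unobservable (S.A i) (S.C i) := by
    unfold unobservable
    rw [LinearMap.mem_ker, mulVecLin_apply]
    ext ⟨t, s⟩
    have := mem_sensorUnobservable_iff.1 (hx s) t
    rw [dotProduct_mulVec] at this
    exact this
  rw [h] at this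
  simpa using this

variable [NeZero l] (T : S.Transforms)

/-- The columns of `Tuo` span the unobservable subspace of mode 0, which by `hnull` is also that of
mode i and hence invariant under `S.A i`. So `So * S.A i` kills `Tuo` and factors through `So`. -/
lemma subA_mul_So
    (hnull : ∀ s i j, S.sensorUnobservable i s = S.sensorUnobservable j s)
    (i : Fin l) (s : Fin m) : subA T i s * (T s).So = (T s).So * S.A i := by
  have h0 : (T s).So * S.A i * (T s).Tuo = 0 := by
    refine Matrix.ext_of_mulVec_single fun j => ?_
    rw [zero_mulVec, ← mulVec_mulVec, ← mulVec_mulVec]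
    apply AdaptedTransform.So_mulVec_eq_zero
    exact (hnull s 0 i).ge (mulVec_mem_sensorUnobservable
      ((hnull s 0 i).le ((T s).Tuo_mulVec_mem _)))
  calc subA T i s * (T s).So = (T s).So * S.A i * ((T s).To * (T s).So) := by
        simp only [subA, Matrix.mul_assoc]
    _ = (T s).So * S.A i * ((T s).Tuo * (T s).Tinv.toRows₁ + (T s).To * (T s).So) := by
        rw [Matrix.mul_add, ← Matrix.mul_assoc _ (T s).Tuo, h0, Matrix.zero_mul, zero_add]
    _ = _ := by rw [AdaptedTransform.Tuo_mul_add_To_mul, Matrix.mul_one]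

lemma subC_vecMul_So
    (hnull : ∀ s i j, S.sensorUnobservable i s = S.sensorUnobservable j s)
    (i : Fin l) (s : Fin m) : subC T i s ᵥ* (T s).So = S.C i s := by
  have h0 : S.C i s ᵥ* (T s).Tuo = 0 := by
    ext j
    have : (T s).Tuo *ᵥ Pi.single j 1 ∈ S.sensorUnobservable i s :=
      (hnull s 0 i).le ((T s).Tuo_mulVec_mem _)
    have := mem_sensorUnobservable_iff.1 this 0
    rw [pow_zero, one_mulVec, mulVec_single_one] at this
    exact this
  calc subC T i s ᵥ* (T s).So = S.C i s ᵥ* ((T s).To * (T s).So) := by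
        rw [subC, vecMul_vecMul]
    _ = S.C i s ᵥ* ((T s).Tuo * (T s).Tinv.toRows₁ + (T s).To * (T s).So) := by
        rw [vecMul_add, ← vecMul_vecMul (M := (T s).Tuo), h0, zero_vecMul, zero_add]
    _ = _ := by rw [AdaptedTransform.Tuo_mul_add_To_mul, vecMul_one]

lemma So_mulVec_mulVec
    (hnull : ∀ s i j, S.sensorUnobservable i s = S.sensorUnobservable j s)
    (i : Fin l) (s : Fin m) (x : Fin n → ℝ) :
    (T s).So *ᵥ (S.A i *ᵥ x) = subA T i s *ᵥ ((T s).So *ᵥ x) := by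
  rw [mulVec_mulVec, mulVec_mulVec, subA_mul_So T hnull]

lemma subC_dotProduct_So_mulVec
    (hnull : ∀ s i j, S.sensorUnobservable i s = S.sensorUnobservable j s)
    (i : Fin l) (s : Fin m) (x : Fin n → ℝ) :
    subC T i s ⬝ᵥ ((T s).So *ᵥ x) = S.C i s ⬝ᵥ x := by
  rw [dotProduct_mulVec, subC_vecMul_So T hnull]

/-- The subsystem seen by a single sensor is observable in every mode. -/
lemma sub_observable
    (hnull : ∀ s i j, S.sensorUnobservable i s = S.sensorUnobservable j s)
    (i : Fin l) (s : Fin m) (z : Fin (T s).dimO → ℝ)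
    (hz : ∀ t, subC T i s ⬝ᵥ (subA T i s ^ t *ᵥ z) = 0) : z = 0 := by
  have hz' : (T s).So *ᵥ ((T s).To *ᵥ z) = z := by
    rw [mulVec_mulVec, AdaptedTransform.So_mul_To, one_mulVec]
  have hpow (t : ℕ) (x : Fin n → ℝ) :
      (T s).So *ᵥ (S.A i ^ t *ᵥ x) = subA T i s ^ t *ᵥ ((T s).So *ᵥ x) := by
    induction t with
    | zero => simp
    | succ t ih =>
      rw [pow_succ', ← mulVec_mulVec, So_mulVec_mulVec T hnull, ih, pow_succ', ← mulVec_mulVec]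
  -- The lift `To z` produces the same outputs as z. If these vanish, the lift is unobservable, and
  -- `So` annihilates it.
  rw [← hz']
  apply AdaptedTransform.So_mulVec_eq_zero
  refine (hnull s 0 i).ge (mem_sensorUnobservable_iff.2 fun t => ?_)
  rw [← subC_dotProduct_So_mulVec T hnull, hpow, hz']
  exact hz t

lemma exists_sub_deadbeat_gain
    (hnull : ∀ s i j, S.sensorUnobservable i s = S.sensorUnobservable j s)
    (i : Fin l) (s : Fin m) :
    ∃ L : Fin (T s).dimO → ℝ,
      (subA T i s * (1 - vecMulVec L (subC T i s))) ^ (T s).dimO = 0 :=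
  exists_deadbeat_gain _ _ (sub_observable T hnull i s)

end SwitchedSystem

/-! ### Second moments, uncorrelatedness and Gaussian vectors. -/

section SecondMoment

variable {Ω : Type*} [MeasurableSpace Ω] {μ : Measure Ω} {ι ι' ι'' : Type*}
  [Fintype ι] [Fintype ι'] [Fintype ι'']

/-- A random vector all of whose components are square integrable. -/
def IsL2Vec (μ : Measure Ω) (X : Ω → ι → ℝ) : Prop := ∀ a, MemLp (fun ω => X ω a) 2 μ

/-- The matrix `𝔼[X Yᵀ]` of mixed second moments. -/
def secondMoment (μ : Measure Ω) (X : Ω → ι → ℝ) (Y : Ω → ι' → ℝ) : Matrix ι ι' ℝ :=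
  Matrix.of fun a b => ∫ ω, X ω a * Y ω b ∂μ

omit [Fintype ι] [Fintype ι'] in
lemma secondMoment_transpose (X : Ω → ι → ℝ) (Y : Ω → ι' → ℝ) :
    (secondMoment μ X Y)ᵀ = secondMoment μ Y X := by
  ext a b
  simp [secondMoment, mul_comm]

omit [Fintype ι] [Fintype ι'] in
lemma IsL2Vec.integrable_mul {X : Ω → ι → ℝ} {Y : Ω → ι' → ℝ} (hX : IsL2Vec μ X)
    (hY : IsL2Vec μ Y) (a : ι) (b : ι') : Integrable (fun ω => X ω a * Y ω b) μ :=
  (hX a).integrable_mul (hY b)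

omit [Fintype ι] in
lemma IsL2Vec.add {X X' : Ω → ι → ℝ} (hX : IsL2Vec μ X) (hX' : IsL2Vec μ X') :
    IsL2Vec μ (fun ω => X ω + X' ω) := fun a => (hX a).add (hX' a)

omit [Fintype ι'] in
lemma IsL2Vec.mulVec {X : Ω → ι → ℝ} (hX : IsL2Vec μ X) (M : Matrix ι' ι ℝ) :
    IsL2Vec μ (fun ω => M *ᵥ X ω) := fun a =>
  memLp_finsetSum _ fun b _ => (hX b).const_mul (M a b)

omit [Fintype ι] [Fintype ι'] in
lemma secondMoment_add_left {X X' : Ω → ι → ℝ} {Y : Ω → ι' → ℝ} (hX : IsL2Vec μ X)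
    (hX' : IsL2Vec μ X') (hY : IsL2Vec μ Y) :
    secondMoment μ (fun ω => X ω + X' ω) Y = secondMoment μ X Y + secondMoment μ X' Y := by
  ext a b
  simp only [secondMoment, Matrix.of_apply, Matrix.add_apply, Pi.add_apply, add_mul]
  exact integral_add (hX.integrable_mul hY a b) (hX'.integrable_mul hY a b)

omit [Fintype ι'] [Fintype ι''] in
lemma secondMoment_mulVec_left {X : Ω → ι → ℝ} {Y : Ω → ι' → ℝ} (hX : IsL2Vec μ X)
    (hY : IsL2Vec μ Y) (M : Matrix ι'' ι ℝ) :
    secondMoment μ (fun ω => M *ᵥ X ω) Y = M * secondMoment μ X Y := by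
  ext a b
  simp only [secondMoment, Matrix.of_apply, Matrix.mul_apply, mulVec, dotProduct, Finset.sum_mul]
  rw [integral_finsetSum _ fun c _ => by
    simpa only [mul_assoc] using (hX.integrable_mul hY c b).const_mul (M a c)]
  simp only [mul_assoc, integral_const_mul]

omit [Fintype ι] [Fintype ι'] in
lemma secondMoment_add_right {X : Ω → ι → ℝ} {Y Y' : Ω → ι' → ℝ} (hX : IsL2Vec μ X)
    (hY : IsL2Vec μ Y) (hY' : IsL2Vec μ Y') :
    secondMoment μ X (fun ω => Y ω + Y' ω) = secondMoment μ X Y + secondMoment μ X Y' := by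
  rw [← secondMoment_transpose, secondMoment_add_left hY hY' hX, transpose_add,
    secondMoment_transpose, secondMoment_transpose]

omit [Fintype ι] [Fintype ι''] in
lemma secondMoment_mulVec_right {X : Ω → ι → ℝ} {Y : Ω → ι' → ℝ} (hX : IsL2Vec μ X)
    (hY : IsL2Vec μ Y) (M : Matrix ι'' ι' ℝ) :
    secondMoment μ X (fun ω => M *ᵥ Y ω) = secondMoment μ X Y * Mᵀ := by
  rw [← secondMoment_transpose, secondMoment_mulVec_left hY hX, transpose_mul,
    secondMoment_transpose]

/-- The quadratic form at x is the expectation of (x · X)². -/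
lemma secondMoment_self_posSemidef {X : Ω → ι → ℝ} (hX : IsL2Vec μ X) :
    (secondMoment μ X X).PosSemidef := by
  refine .of_dotProduct_mulVec_nonneg ?_ fun x => ?_
  · rw [IsHermitian, conjTranspose_eq_transpose_of_trivial, secondMoment_transpose]
  · have h1 := secondMoment_mulVec_left (hX := hX) (hY := hX.mulVec (replicateRow Unit x))
      (replicateRow Unit x)
    rw [secondMoment_mulVec_right hX hX] at h1
    have h2 := congrFun (congrFun h1 ()) ()
    have h3 : x ⬝ᵥ (secondMoment μ X X *ᵥ x) =
        (replicateRow Unit x * (secondMoment μ X X * (replicateRow Unit x)ᵀ)) () () := by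
      simp [Matrix.mul_apply, dotProduct, mulVec]
    rw [star_trivial, h3, ← h2]
    exact integral_nonneg fun ω => mul_self_nonneg _

end SecondMoment

section CenteredUncorr

variable {Ω : Type*} [MeasurableSpace Ω] {μ : Measure Ω} {J : Type*} {d : J → ℕ}
  {ι ι' : Type*} [Fintype ι] [Fintype ι']

/-- `X` is square integrable, has mean zero, and is uncorrelated with all `Z i`, `i ∉ s`. -/
structure CenteredUncorr (μ : Measure Ω) (Z : ∀ i : J, Ω → EuclideanSpace ℝ (Fin (d i)))
    (s : Set J) (X : Ω → ι → ℝ) : Prop where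
  isL2 : IsL2Vec μ X
  mean : ∀ a, ∫ ω, X ω a ∂μ = 0
  uncorr : ∀ i ∉ s, secondMoment μ X (fun ω => (Z i ω).ofLp) = 0

variable {Z : ∀ i : J, Ω → EuclideanSpace ℝ (Fin (d i))}

omit [Fintype ι] in
lemma CenteredUncorr.mono {s t : Set J} {X : Ω → ι → ℝ} (h : CenteredUncorr μ Z s X)
    (hst : s ⊆ t) : CenteredUncorr μ Z t X :=
  ⟨h.isL2, h.mean, fun i hi => h.uncorr i fun his => hi (hst his)⟩

omit [Fintype ι] in
lemma CenteredUncorr.add [IsFiniteMeasure μ] (hZ : ∀ i, IsL2Vec μ fun ω => (Z i ω).ofLp)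
    {s : Set J} {X X' : Ω → ι → ℝ} (h : CenteredUncorr μ Z s X) (h' : CenteredUncorr μ Z s X') :
    CenteredUncorr μ Z s (fun ω => X ω + X' ω) where
  isL2 := h.isL2.add h'.isL2
  mean a := by
    simp only [Pi.add_apply]
    rw [integral_add ((h.isL2 a).integrable one_le_two) ((h'.isL2 a).integrable one_le_two),
      h.mean, h'.mean, add_zero]
  uncorr i hi := by
    rw [secondMoment_add_left h.isL2 h'.isL2 (hZ i), h.uncorr i hi, h'.uncorr i hi, add_zero]

omit [Fintype ι'] in
lemma CenteredUncorr.mulVec [IsFiniteMeasure μ] (hZ : ∀ i, IsL2Vec μ fun ω => (Z i ω).ofLp)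
    {s : Set J} {X : Ω → ι → ℝ} (h : CenteredUncorr μ Z s X) (M : Matrix ι' ι ℝ) :
    CenteredUncorr μ Z s (fun ω => M *ᵥ X ω) where
  isL2 := h.isL2.mulVec M
  mean a := by
    simp only [Matrix.mulVec, dotProduct]
    rw [integral_finsetSum _ fun c _ => ((h.isL2 c).integrable one_le_two).const_mul _]
    simp [integral_const_mul, h.mean]
  uncorr i hi := by
    rw [secondMoment_mulVec_left h.isL2 (hZ i), h.uncorr i hi, Matrix.mul_zero]

/-- Centering a member of an independent family. -/
lemma ProbabilityTheory.iIndepFun.centeredUncorr [IsProbabilityMeasure μ] (hind : iIndepFun Z μ)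
    (hZ : ∀ i, IsL2Vec μ fun ω => (Z i ω).ofLp) (i : J) (c : Fin (d i) → ℝ)
    (hc : ∀ a, ∫ ω, Z i ω a ∂μ = c a) :
    CenteredUncorr μ Z {i} (fun ω => (Z i ω).ofLp - c) where
  isL2 a := (hZ i a).sub (memLp_const _)
  mean a := by
    simp only [Pi.sub_apply]
    rw [integral_sub ((hZ i a).integrable one_le_two) (integrable_const _), hc]
    simp
  uncorr j hj := by
    ext a b
    have hij : IndepFun (Z i) (Z j) μ := hind.indepFun fun h => hj h.symm
    have : IndepFun (fun ω => (Z i ω).ofLp a - c a) (fun ω => (Z j ω).ofLp b) μ :=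
      hij.comp (φ := fun x : EuclideanSpace ℝ (Fin (d i)) => x.ofLp a - c a)
        (ψ := fun x : EuclideanSpace ℝ (Fin (d j)) => x.ofLp b) (by fun_prop) (by fun_prop)
    simp only [secondMoment, Matrix.of_apply, Pi.sub_apply, Matrix.zero_apply]
    rw [this.integral_fun_mul_eq_mul_integral ((hZ i a).sub (memLp_const _)).1 (hZ j b).1,
      integral_sub ((hZ i a).integrable one_le_two) (integrable_const _), hc]
    simp

end CenteredUncorr

section Gaussian

variable {Ω : Type*} [MeasurableSpace Ω] {μ : Measure Ω} {ι : Type*} [Fintype ι] [DecidableEq ι]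
  {X : Ω → EuclideanSpace ℝ ι} {c : EuclideanSpace ℝ ι} {P : Matrix ι ι ℝ}

lemma memLp_eval_multivariateGaussian (a : ι) :
    MemLp (fun x : EuclideanSpace ℝ ι => x a) 2 (multivariateGaussian c P) :=
  (EuclideanSpace.proj a : EuclideanSpace ℝ ι →L[ℝ] ℝ).comp_memLp' IsGaussian.memLp_two_id

lemma integral_eval_multivariateGaussian (a : ι) :
    ∫ x : EuclideanSpace ℝ ι, x a ∂(multivariateGaussian c P) = c a := by
  have := (EuclideanSpace.proj a : EuclideanSpace ℝ ι →L[ℝ] ℝ).integral_comp_id_comm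
    (μ := multivariateGaussian c P) IsGaussian.integrable_id
  simpa using this

lemma isL2Vec_of_hasLaw_multivariateGaussian (hX : HasLaw X (multivariateGaussian c P) μ) :
    IsL2Vec μ (fun ω => (X ω).ofLp) := fun a => by
  have := memLp_eval_multivariateGaussian (c := c) (P := P) a
  rw [← hX.map_eq] at this
  exact this.comp_of_map hX.aemeasurable

lemma integral_of_hasLaw_multivariateGaussian (hX : HasLaw X (multivariateGaussian c P) μ)
    (a : ι) : ∫ ω, X ω a ∂μ = c a := by
  rw [← integral_eval_multivariateGaussian (c := c) (P := P) a]
  exact hX.integral_comp (memLp_eval_multivariateGaussian a).1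

lemma secondMoment_of_hasLaw_multivariateGaussian (hP : P.PosSemidef)
    (hX : HasLaw X (multivariateGaussian c P) μ) :
    secondMoment μ (fun ω => (X ω).ofLp - c.ofLp) (fun ω => (X ω).ofLp - c.ofLp) = P := by
  ext a b
  rw [← covariance_eval_multivariateGaussian (μ := c) hP, covariance,
    integral_eval_multivariateGaussian, integral_eval_multivariateGaussian]
  exact hX.integral_comp (f := fun x : EuclideanSpace ℝ ι => (x a - c a) * (x b - c b))
    (by fun_prop)

end Gaussian

/-- Both cross terms drop out. Measurement update, time update and fusion noise are all instances of
this identity. -/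
lemma secondMoment_mulVec_add_mulVec {Ω : Type*} [MeasurableSpace Ω] {μ : Measure Ω}
    {ι₁ ι₂ κ₁ κ₂ ι ι' : Type*} [Fintype ι₁] [Fintype ι₂] [Fintype κ₁] [Fintype κ₂]
    {X : Ω → ι₁ → ℝ} {Y : Ω → κ₁ → ℝ} {X' : Ω → ι₂ → ℝ} {Y' : Ω → κ₂ → ℝ}
    [Fintype ι] [Fintype ι']
    (hX : IsL2Vec μ X) (hY : IsL2Vec μ Y) (hX' : IsL2Vec μ X') (hY' : IsL2Vec μ Y')
    (hXY' : secondMoment μ X Y' = 0) (hX'Y : secondMoment μ X' Y = 0)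
    (M : Matrix ι ι₁ ℝ) (N : Matrix ι κ₁ ℝ) (M' : Matrix ι' ι₂ ℝ) (N' : Matrix ι' κ₂ ℝ) :
    secondMoment μ (fun ω => M *ᵥ X ω + N *ᵥ Y ω) (fun ω => M' *ᵥ X' ω + N' *ᵥ Y' ω) =
      M * secondMoment μ X X' * M'ᵀ + N * secondMoment μ Y Y' * N'ᵀ := by
  have hYX' : secondMoment μ Y X' = 0 := by
    rw [← secondMoment_transpose, hX'Y, transpose_zero]
  rw [secondMoment_add_left (hX.mulVec M) (hY.mulVec N) ((hX'.mulVec M').add (hY'.mulVec N')),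
    secondMoment_add_right (hX.mulVec M) (hX'.mulVec M') (hY'.mulVec N'),
    secondMoment_add_right (hY.mulVec N) (hX'.mulVec M') (hY'.mulVec N'),
    secondMoment_mulVec_left hX (hX'.mulVec M'), secondMoment_mulVec_left hX (hY'.mulVec N'),
    secondMoment_mulVec_left hY (hX'.mulVec M'), secondMoment_mulVec_left hY (hY'.mulVec N'),
    secondMoment_mulVec_right hX hX', secondMoment_mulVec_right hX hY',
    secondMoment_mulVec_right hY hX', secondMoment_mulVec_right hY hY', hXY', hYX']
  simp [Matrix.mul_assoc]

/-! ### The filter matrices are the error covariances. -/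

/-- The noises up to (excluding) times `p` for the process and `q` for the sensors. -/
def pastNoise (m p q : ℕ) : Set (NoiseIndex m) :=
  {i | match i with
    | .init => True
    | .process j => j < p
    | .sensor j => j < q
    | .artificial _ _ => False}

lemma pastNoise_mono {m p p' q q' : ℕ} (hp : p ≤ p') (hq : q ≤ q') :
    pastNoise m p q ⊆ pastNoise m p' q' := by
  rintro (_ | j | j | ⟨j, s⟩) h
  · trivial
  · exact lt_of_lt_of_le (show j < p from h) hp
  · exact lt_of_lt_of_le (show j < q from h) hq
  · exact h.elim

namespace SwitchedSystem

variable {l m n : ℕ} {S : SwitchedSystem l m n} {σ : ℝ} {Ω : Type*} [MeasurableSpace Ω]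
  {μ : Measure Ω} {x0 : Ω → EuclideanSpace ℝ (Fin n)}
  {w : ℕ → Ω → EuclideanSpace ℝ (Fin n)} {v : ℕ → Ω → EuclideanSpace ℝ (Fin m)}
  {α : ℕ → Fin m → Ω → EuclideanSpace ℝ (Fin n)}

lemma IsNoise.isL2 (h : S.IsNoise σ μ x0 w v α) (i : NoiseIndex m) :
    IsL2Vec μ fun ω => (noiseFamily x0 w v α i ω).ofLp := by
  cases i with
  | init => exact isL2Vec_of_hasLaw_multivariateGaussian h.init
  | process k => exact isL2Vec_of_hasLaw_multivariateGaussian (h.process k)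
  | sensor k => exact isL2Vec_of_hasLaw_multivariateGaussian (h.sensor k)
  | artificial k s => exact isL2Vec_of_hasLaw_multivariateGaussian (h.artificial k s)

section

variable [IsProbabilityMeasure μ]

lemma IsNoise.centered_init (h : S.IsNoise σ μ x0 w v α) :
    CenteredUncorr μ (noiseFamily x0 w v α) {.init} fun ω => (x0 ω).ofLp - S.xhat0.ofLp :=
  h.indep.centeredUncorr h.isL2 .init S.xhat0.ofLp
    (integral_of_hasLaw_multivariateGaussian h.init)

lemma IsNoise.centered_process (h : S.IsNoise σ μ x0 w v α) (k : ℕ) :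
    CenteredUncorr μ (noiseFamily x0 w v α) {.process k} fun ω => (w k ω).ofLp := by
  have := h.indep.centeredUncorr h.isL2 (.process k) 0
    (integral_of_hasLaw_multivariateGaussian (h.process k))
  simp only [sub_zero] at this
  exact this

lemma IsNoise.centered_sensor (h : S.IsNoise σ μ x0 w v α) (k : ℕ) :
    CenteredUncorr μ (noiseFamily x0 w v α) {.sensor k} fun ω => (v k ω).ofLp := by
  have := h.indep.centeredUncorr h.isL2 (.sensor k) 0
    (integral_of_hasLaw_multivariateGaussian (h.sensor k))
  simp only [sub_zero] at this
  exact this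

lemma IsNoise.centered_artificial (h : S.IsNoise σ μ x0 w v α) (k : ℕ) (s : Fin m) :
    CenteredUncorr μ (noiseFamily x0 w v α) {.artificial k s} fun ω => (α k s ω).ofLp := by
  have := h.indep.centeredUncorr h.isL2 (.artificial k s) 0
    (integral_of_hasLaw_multivariateGaussian (h.artificial k s))
  simp only [sub_zero] at this
  exact this

end

lemma IsNoise.secondMoment_process (h : S.IsNoise σ μ x0 w v α) (hQ : S.Q.PosSemidef) (k : ℕ) :
    secondMoment μ (fun ω => (w k ω).ofLp) (fun ω => (w k ω).ofLp) = S.Q := by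
  simpa using secondMoment_of_hasLaw_multivariateGaussian hQ (h.process k)

lemma IsNoise.secondMoment_sensor (h : S.IsNoise σ μ x0 w v α) (hR : S.R.PosSemidef) (k : ℕ) :
    secondMoment μ (fun ω => (v k ω).ofLp) (fun ω => (v k ω).ofLp) = S.R := by
  simpa using secondMoment_of_hasLaw_multivariateGaussian hR (h.sensor k)

variable [NeZero l] (T : S.Transforms) (mode : ℕ → Fin l)

section Recursion

variable (x0 : Ω → EuclideanSpace ℝ (Fin n)) (w : ℕ → Ω → EuclideanSpace ℝ (Fin n))
  (v : ℕ → Ω → EuclideanSpace ℝ (Fin m))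

omit [MeasurableSpace Ω] in
lemma priorError_zero (s : Fin m) (ω : Ω) :
    priorError T mode x0 w v 0 s ω = (T s).So *ᵥ ((x0 ω).ofLp - S.xhat0.ofLp) := by
  rw [mulVec_sub]
  rfl

-- The noise enters as the whole vector v_k, from which the unit row vector of s selects one
-- component. Two sensors thus share one noise vector, and its covariance supplies the cross term
-- `S.R s₁ s₂`.
omit [MeasurableSpace Ω] in
lemma postError_eq
    (hnull : ∀ s i j, S.sensorUnobservable i s = S.sensorUnobservable j s)
    (k : ℕ) (s : Fin m) (ω : Ω) :
    postError T mode x0 w v k s ω =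
      updateMatrix T (mode k) s (priorCov T mode k s s) *ᵥ priorError T mode x0 w v k s ω +
        (-vecMulVec (kalmanGain T (mode k) s (priorCov T mode k s s)) (Pi.single s 1)) *ᵥ
          (v k ω).ofLp := by
  have hU (z : Fin (T s).dimO → ℝ) :
      updateMatrix T (mode k) s (priorCov T mode k s s) *ᵥ z =
        z - (subC T (mode k) s ⬝ᵥ z) • kalmanGain T (mode k) s (priorCov T mode k s s) := by
    rw [updateMatrix, sub_mulVec, one_mulVec, vecMulVec_mulVec]
    simp
  have hy : S.output mode (x0 ω) (fun j => w j ω) (fun j => v j ω) k s =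
      subC T (mode k) s ⬝ᵥ ((T s).So *ᵥ S.state mode (x0 ω) (fun j => w j ω) k) + v k ω s := by
    rw [subC_dotProduct_So_mulVec T hnull]
    rfl
  rw [postError, postEst, estUpdate, hy, priorError, mulVec_sub, hU (_ *ᵥ _), neg_mulVec,
    vecMulVec_mulVec, single_one_dotProduct]
  ext a
  simp
  ring

omit [MeasurableSpace Ω] in
lemma priorError_succ
    (hnull : ∀ s i j, S.sensorUnobservable i s = S.sensorUnobservable j s)
    (k : ℕ) (s : Fin m) (ω : Ω) :
    priorError T mode x0 w v (k + 1) s ω =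
      subA T (mode k) s *ᵥ postError T mode x0 w v k s ω + (T s).So *ᵥ (w k ω).ofLp := by
  rw [priorError, state, mulVec_add, So_mulVec_mulVec T hnull, priorEst, postError, mulVec_sub,
    postEst]
  abel

end Recursion

variable [IsProbabilityMeasure μ]

section

variable (h : S.IsNoise σ μ x0 w v α)
  (hnull : ∀ s i j, S.sensorUnobservable i s = S.sensorUnobservable j s)
include h hnull

/-- Conditional on the a priori statement, so that it can serve inside the induction on k that
proves that statement. -/
lemma centeredUncorr_postError_of_priorError {k : ℕ} {s : Fin m}
    (hk : CenteredUncorr μ (noiseFamily x0 w v α) (pastNoise m k k)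
      (priorError T mode x0 w v k s)) :
    CenteredUncorr μ (noiseFamily x0 w v α) (pastNoise m k (k + 1))
      (postError T mode x0 w v k s) := by
  have := ((hk.mulVec h.isL2 (updateMatrix T (mode k) s (priorCov T mode k s s))).mono
    (pastNoise_mono le_rfl k.le_succ)).add h.isL2 (((h.centered_sensor k).mulVec h.isL2
      (-vecMulVec (kalmanGain T (mode k) s (priorCov T mode k s s)) (Pi.single s 1))).mono
        (Set.singleton_subset_iff.2 (show k < k + 1 from k.lt_succ_self)))
  exact (funext (postError_eq T mode x0 w v hnull k s)) ▸ this

lemma centeredUncorr_priorError (k : ℕ) (s : Fin m) :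
    CenteredUncorr μ (noiseFamily x0 w v α) (pastNoise m k k)
      (priorError T mode x0 w v k s) := by
  induction k with
  | zero =>
    rw [funext (priorError_zero T mode x0 w v s)]
    exact (h.centered_init.mulVec h.isL2 _).mono (Set.singleton_subset_iff.2 trivial)
  | succ k ih =>
    rw [funext (priorError_succ T mode x0 w v hnull k s)]
    exact (((centeredUncorr_postError_of_priorError T mode h hnull ih).mulVec h.isL2 _).mono
      (pastNoise_mono k.le_succ le_rfl)).add h.isL2 (((h.centered_process k).mulVec h.isL2 _).mono
        (Set.singleton_subset_iff.2 (show k < k + 1 from k.lt_succ_self)))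

lemma centeredUncorr_postError (k : ℕ) (s : Fin m) :
    CenteredUncorr μ (noiseFamily x0 w v α) (pastNoise m k (k + 1))
      (postError T mode x0 w v k s) :=
  centeredUncorr_postError_of_priorError T mode h hnull
    (centeredUncorr_priorError T mode h hnull k s)

lemma secondMoment_postError_of_priorError (hR : S.R.PosSemidef) {k : ℕ}
    (hk : ∀ s₁ s₂, secondMoment μ (priorError T mode x0 w v k s₁) (priorError T mode x0 w v k s₂) =
      priorCov T mode k s₁ s₂) (s₁ s₂ : Fin m) :
    secondMoment μ (postError T mode x0 w v k s₁) (postError T mode x0 w v k s₂) =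
      postCov T mode k s₁ s₂ := by
  have hc := centeredUncorr_priorError T mode h hnull k
  -- The a priori error involves sensor noise only at times strictly before k.
  have hv : NoiseIndex.sensor k ∉ pastNoise m k k := fun hk => lt_irrefl k hk
  rw [funext (postError_eq T mode x0 w v hnull k s₁), funext (postError_eq T mode x0 w v hnull k s₂),
    secondMoment_mulVec_add_mulVec (hc s₁).isL2 (h.centered_sensor k).isL2 (hc s₂).isL2
      (h.centered_sensor k).isL2 ((hc s₁).uncorr _ hv) ((hc s₂).uncorr _ hv), hk,
    h.secondMoment_sensor hR, postCov, covUpdate]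
  congr 1
  ext a b
  simp [Matrix.mul_apply, vecMulVec_apply, Pi.single_apply]
  ring

lemma secondMoment_priorError (hQ : S.Q.PosSemidef) (hR : S.R.PosSemidef) (hP0 : S.P0.PosSemidef)
    (k : ℕ) (s₁ s₂ : Fin m) :
    secondMoment μ (priorError T mode x0 w v k s₁) (priorError T mode x0 w v k s₂) =
      priorCov T mode k s₁ s₂ := by
  induction k generalizing s₁ s₂ with
  | zero =>
    rw [funext (priorError_zero T mode x0 w v s₁), funext (priorError_zero T mode x0 w v s₂),
      secondMoment_mulVec_left h.centered_init.isL2 (h.centered_init.isL2.mulVec _),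
      secondMoment_mulVec_right h.centered_init.isL2 h.centered_init.isL2,
      secondMoment_of_hasLaw_multivariateGaussian hP0 h.init, ← Matrix.mul_assoc]
    rfl
  | succ k ih =>
    have hc := centeredUncorr_postError T mode h hnull k
    have hw : NoiseIndex.process k ∉ pastNoise m k (k + 1) := fun hk => lt_irrefl k hk
    rw [funext (priorError_succ T mode x0 w v hnull k s₁),
      funext (priorError_succ T mode x0 w v hnull k s₂),
      secondMoment_mulVec_add_mulVec (hc s₁).isL2 (h.centered_process k).isL2 (hc s₂).isL2
        (h.centered_process k).isL2 ((hc s₁).uncorr _ hw) ((hc s₂).uncorr _ hw),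
      secondMoment_postError_of_priorError T mode h hnull hR ih, h.secondMoment_process hQ]
    rfl

lemma secondMoment_postError (hQ : S.Q.PosSemidef) (hR : S.R.PosSemidef) (hP0 : S.P0.PosSemidef)
    (k : ℕ) (s₁ s₂ : Fin m) :
    secondMoment μ (postError T mode x0 w v k s₁) (postError T mode x0 w v k s₂) =
      postCov T mode k s₁ s₂ :=
  secondMoment_postError_of_priorError T mode h hnull hR
    (secondMoment_priorError T mode h hnull hQ hR hP0 k) s₁ s₂

/-- Positivity comes from the probabilistic meaning of the matrix, not from its recursion. -/
lemma priorCov_posSemidef (hQ : S.Q.PosSemidef) (hR : S.R.PosSemidef) (hP0 : S.P0.PosSemidef)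
    (k : ℕ) (s : Fin m) : (priorCov T mode k s s).PosSemidef := by
  rw [← secondMoment_priorError T mode h hnull hQ hR hP0]
  exact secondMoment_self_posSemidef (centeredUncorr_priorError T mode h hnull k s).isL2

end

end SwitchedSystem

/-! ### Comparison for the Riccati recursion and the uniform bound. -/

section Riccati

variable {d e : Type*} [Fintype d] [Fintype e]

lemma dotProduct_mul_mul_transpose_mulVec (M : Matrix d e ℝ) (P : Matrix e e ℝ) (x : d → ℝ) :
    x ⬝ᵥ ((M * P * Mᵀ) *ᵥ x) = (x ᵥ* M) ⬝ᵥ (P *ᵥ (x ᵥ* M)) := by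
  rw [← mulVec_mulVec, ← mulVec_mulVec, mulVec_transpose, dotProduct_mulVec x M]

variable [DecidableEq d]

/-- For fixed x the gain enters only through the scalar x · L, in a quadratic polynomial whose
leading coefficient is the innovation variance. -/
lemma joseph_quadForm {P : Matrix d d ℝ} (hP : P.PosSemidef) (r : ℝ) (c L x : d → ℝ) :
    x ⬝ᵥ (((1 - vecMulVec L c) * P * (1 - vecMulVec L c)ᵀ + r • vecMulVec L L) *ᵥ x) =
      x ⬝ᵥ (P *ᵥ x) - 2 * (x ⬝ᵥ L) * (x ⬝ᵥ (P *ᵥ c)) +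
        (x ⬝ᵥ L) ^ 2 * (c ⬝ᵥ (P *ᵥ c) + r) := by
  have hsymm : c ⬝ᵥ (P *ᵥ x) = x ⬝ᵥ (P *ᵥ c) := by
    have : Pᵀ = P := by
      rw [← conjTranspose_eq_transpose_of_trivial]
      exact hP.1
    rw [dotProduct_mulVec, ← mulVec_transpose, this, dotProduct_comm]
  have hx : x ᵥ* (1 - vecMulVec L c) = x - (x ⬝ᵥ L) • c := by
    rw [vecMul_sub, vecMul_one, vecMul_vecMulVec]
  rw [add_mulVec, dotProduct_add, dotProduct_mul_mul_transpose_mulVec, hx, smul_mulVec,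
    vecMulVec_mulVec]
  simp only [mulVec_sub, mulVec_smul, dotProduct_sub, sub_dotProduct, dotProduct_smul,
    smul_dotProduct, smul_eq_mul, hsymm,
    op_smul_eq_smul, dotProduct_comm L x]
  ring

/-- The Kalman gain minimizes the posterior error covariance among all gains. -/
lemma joseph_quadForm_kalmanGain_le {P : Matrix d d ℝ} (hP : P.PosSemidef) {r : ℝ} (hr : 0 < r)
    (c L x : d → ℝ) {K : d → ℝ} (hK : K = (c ⬝ᵥ (P *ᵥ c) + r)⁻¹ • (P *ᵥ c)) :
    x ⬝ᵥ (((1 - vecMulVec K c) * P * (1 - vecMulVec K c)ᵀ + r • vecMulVec K K) *ᵥ x) ≤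
      x ⬝ᵥ (((1 - vecMulVec L c) * P * (1 - vecMulVec L c)ᵀ + r • vecMulVec L L) *ᵥ x) := by
  have hS : 0 < c ⬝ᵥ (P *ᵥ c) + r := by
    have := hP.dotProduct_mulVec_nonneg c
    rw [star_trivial] at this
    linarith
  rw [joseph_quadForm hP, joseph_quadForm hP]
  have hxK : x ⬝ᵥ (P *ᵥ c) = (c ⬝ᵥ (P *ᵥ c) + r) * (x ⬝ᵥ K) := by
    rw [hK, dotProduct_smul, smul_eq_mul, mul_inv_cancel_left₀ hS.ne']
  rw [hxK]
  -- Completing the square: the two sides differ by the innovation variance times (x · L - x · K)².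
  nlinarith [mul_nonneg hS.le (sq_nonneg (x ⬝ᵥ L - x ⬝ᵥ K))]

end Riccati

namespace SwitchedSystem

variable {l m n : ℕ} {S : SwitchedSystem l m n} [NeZero l] (T : S.Transforms)

/-- The error dynamics of the observer of sensor `s` in mode `i` with gain `L`. -/
def observerMatrix (i : Fin l) (s : Fin m) (L : Fin (T s).dimO → ℝ) :
    Matrix (Fin (T s).dimO) (Fin (T s).dimO) ℝ :=
  subA T i s * (1 - vecMulVec L (subC T i s))

/-- The quadratic form of the noise entering the error of the observer with gain `L`. -/
def observerNoise (i : Fin l) (s : Fin m) (L x : Fin (T s).dimO → ℝ) : ℝ :=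
  S.R s s * ((x ᵥ* subA T i s) ⬝ᵥ L) ^ 2 + x ⬝ᵥ (((T s).So * S.Q * (T s).Soᵀ) *ᵥ x)

variable {T} {mode : ℕ → Fin l} {k : ℕ} {s : Fin m}

lemma dotProduct_postCov_le (hR : S.R.PosDef) (hP : (priorCov T mode k s s).PosSemidef)
    (L x : Fin (T s).dimO → ℝ) :
    x ⬝ᵥ (postCov T mode k s s *ᵥ x) ≤
      (x ᵥ* (1 - vecMulVec L (subC T (mode k) s))) ⬝ᵥ
        (priorCov T mode k s s *ᵥ (x ᵥ* (1 - vecMulVec L (subC T (mode k) s)))) +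
          S.R s s * (x ⬝ᵥ L) ^ 2 := by
  refine (joseph_quadForm_kalmanGain_le hP hR.diag_pos (subC T (mode k) s) L x rfl).trans_eq ?_
  rw [add_mulVec, dotProduct_add, dotProduct_mul_mul_transpose_mulVec, smul_mulVec,
    vecMulVec_mulVec]
  simp only [dotProduct_smul, smul_eq_mul, op_smul_eq_smul, dotProduct_comm L x]
  ring

/-- Compare with the gain 0, which ignores the measurement. -/
lemma dotProduct_postCov_le_priorCov (hR : S.R.PosDef) (hP : (priorCov T mode k s s).PosSemidef)
    (x : Fin (T s).dimO → ℝ) :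
    x ⬝ᵥ (postCov T mode k s s *ᵥ x) ≤ x ⬝ᵥ (priorCov T mode k s s *ᵥ x) := by
  simpa using dotProduct_postCov_le hR hP 0 x

lemma dotProduct_priorCov_succ_le (hR : S.R.PosDef) (hP : (priorCov T mode k s s).PosSemidef)
    (L x : Fin (T s).dimO → ℝ) :
    x ⬝ᵥ (priorCov T mode (k + 1) s s *ᵥ x) ≤
      (x ᵥ* observerMatrix T (mode k) s L) ⬝ᵥ
        (priorCov T mode k s s *ᵥ (x ᵥ* observerMatrix T (mode k) s L)) +
          observerNoise T (mode k) s L x := by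
  have h := dotProduct_postCov_le hR hP L (x ᵥ* subA T (mode k) s)
  rw [vecMul_vecMul] at h
  have h' : x ⬝ᵥ (priorCov T mode (k + 1) s s *ᵥ x) =
      (x ᵥ* subA T (mode k) s) ⬝ᵥ (postCov T mode k s s *ᵥ (x ᵥ* subA T (mode k) s)) +
        x ⬝ᵥ (((T s).So * S.Q * (T s).Soᵀ) *ᵥ x) := by
    rw [← dotProduct_mul_mul_transpose_mulVec, ← dotProduct_add, ← add_mulVec]
    rfl
  rw [h']
  unfold observerNoise observerMatrix
  linarith

/-- Once t reaches the nilpotency index of a deadbeat gain, the old covariance disappears and only a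
noise sum is left. -/
lemma dotProduct_priorCov_add_le (hR : S.R.PosDef)
    (hP : ∀ k, (priorCov T mode k s s).PosSemidef) {i : Fin l} (L : Fin (T s).dimO → ℝ)
    (k t : ℕ) (hmode : ∀ j < t, mode (k + j) = i) (x : Fin (T s).dimO → ℝ) :
    x ⬝ᵥ (priorCov T mode (k + t) s s *ᵥ x) ≤
      (x ᵥ* observerMatrix T i s L ^ t) ⬝ᵥ
        (priorCov T mode k s s *ᵥ (x ᵥ* observerMatrix T i s L ^ t)) +
          ∑ j ∈ Finset.range t, observerNoise T i s L (x ᵥ* observerMatrix T i s L ^ j) := by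
  -- The dynamics act on the test vector from the right, so the induction hypothesis is needed at x
  -- F.
  induction t generalizing x with
  | zero => simp
  | succ t ih =>
    have h1 := dotProduct_priorCov_succ_le hR (hP (k + t)) L x
    rw [hmode t t.lt_succ_self] at h1
    have h2 := ih (fun j hj => hmode j (hj.trans t.lt_succ_self))
      (x ᵥ* observerMatrix T i s L)
    rw [Finset.sum_range_succ', pow_zero, vecMul_one]
    simp only [vecMul_vecMul, ← pow_succ'] at h2
    rw [← add_assoc k t 1]
    linarith

/-- Uniform bound on the a priori error variances when modes persist for at least `n` steps. -/
lemma exists_priorCov_le (hR : S.R.PosDef)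
    (hnull : ∀ s i j, S.sensorUnobservable i s = S.sensorUnobservable j s)
    {κ : ℕ} (hκ : n ≤ κ) (s : Fin m) (x : Fin (T s).dimO → ℝ) :
    ∃ M : ℝ, ∀ mode : ℕ → Fin l, (∀ j k, j / κ = k / κ → mode j = mode k) →
      (∀ k, (priorCov T mode k s s).PosSemidef) →
      ∀ k, x ⬝ᵥ (priorCov T mode k s s *ᵥ x) ≤ M := by
  choose L hL using fun i => exists_sub_deadbeat_gain T hnull i s
  have hdn : (T s).dimO ≤ n := (T s).dimO_le
  let F (i : Fin l) := observerMatrix T i s (L i)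
  have hF (i : Fin l) : F i ^ (T s).dimO = 0 := hL i
  let G (i : Fin l) (t : ℕ) (x : Fin (T s).dimO → ℝ) : ℝ :=
    ∑ j ∈ Finset.range t, observerNoise T i s (L i) (x ᵥ* F i ^ j)
  let P := (T s).So * S.P0 * (T s).Soᵀ
  -- The index holds the current mode, the previous mode and the number of steps traced back in the
  -- current block. The maximum covers both possible origins: noise left after a reset in the
  -- previous block, or the initial covariance.
  let B (p : Fin l × Fin l × Fin ((T s).dimO + 1)) : ℝ :=
    max (G p.2.1 (T s).dimO (x ᵥ* F p.1 ^ (p.2.2 : ℕ)))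
      ((x ᵥ* F p.1 ^ (p.2.2 : ℕ)) ⬝ᵥ (P *ᵥ (x ᵥ* F p.1 ^ (p.2.2 : ℕ)))) + G p.1 p.2.2 x
  obtain ⟨M, hM⟩ := (Set.finite_range B).bddAbove
  refine ⟨M, fun mode hmode hP k => ?_⟩
  -- For κ = 0 also `dimO` = 0, and every quadratic form is zero.
  rcases Nat.eq_zero_or_pos κ with rfl | hκ0
  · have h0 : (T s).dimO = 0 := by omega
    have : IsEmpty (Fin (T s).dimO) := by rw [h0]; infer_instance
    have h1 := hM ⟨(mode 0, mode 0, 0), rfl⟩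
    have h2 : B (mode 0, mode 0, 0) = 0 := by
      simp [B, G, h0, dotProduct]
    rw [h2] at h1
    simpa [dotProduct] using h1
  have hblock (q r : ℕ) (hr : r < κ) : mode (q * κ + r) = mode (q * κ) := by
    apply hmode
    rw [Nat.mul_div_cancel _ hκ0, mul_comm, Nat.mul_add_div hκ0, Nat.div_eq_of_lt hr, add_zero]
  obtain ⟨q, r, hr, rfl⟩ : ∃ q r, r < κ ∧ k = q * κ + r :=
    ⟨k / κ, k % κ, Nat.mod_lt _ hκ0, by rw [mul_comm]; exact (Nat.div_add_mod k κ).symm⟩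
  rcases le_or_gt (T s).dimO r with hdr | hrd
  · have h := dotProduct_priorCov_add_le hR hP (i := mode (q * κ)) (L (mode (q * κ)))
      (q * κ + (r - (T s).dimO)) (T s).dimO (fun j hj => by rw [add_assoc]; exact hblock q _ (by omega)) x
    rw [show q * κ + (r - (T s).dimO) + (T s).dimO = q * κ + r by omega] at h
    refine (h.trans ?_).trans (hM ⟨(mode (q * κ), mode (q * κ), Fin.last (T s).dimO), rfl⟩)
    have h0 : observerMatrix T (mode (q * κ)) s (L (mode (q * κ))) ^ (T s).dimO = 0 := hF _
    rw [h0, vecMul_zero, zero_dotProduct]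
    refine add_le_add (le_max_of_le_right ?_) le_rfl
    simp [hF]
  · have h := dotProduct_priorCov_add_le hR hP (i := mode (q * κ)) (L (mode (q * κ)))
      (q * κ) r (fun j hj => hblock q _ (by omega)) x
    rcases q with _ | q
    · refine h.trans (le_trans ?_ (hM ⟨(mode (0 * κ), mode 0, ⟨r, by omega⟩), rfl⟩))
      refine add_le_add (le_max_of_le_right ?_) le_rfl
      simp only [zero_mul]
      exact le_rfl
    · refine h.trans (le_trans ?_ (hM ⟨(mode ((q + 1) * κ), mode (q * κ), ⟨r, by omega⟩), rfl⟩))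
      refine add_le_add (le_max_of_le_left ?_) le_rfl
      -- The reset happens in the last `dimO` steps of the previous block.
      have h' := dotProduct_priorCov_add_le hR hP (i := mode (q * κ)) (L (mode (q * κ)))
        (q * κ + (κ - (T s).dimO)) (T s).dimO (fun j hj => by rw [add_assoc]; exact hblock q _ (by omega))
        (x ᵥ* F (mode ((q + 1) * κ)) ^ r)
      rw [show q * κ + (κ - (T s).dimO) + (T s).dimO = (q + 1) * κ by rw [add_one_mul]; omega] at h'
      refine h'.trans_eq ?_
      have h0 : observerMatrix T (mode (q * κ)) s (L (mode (q * κ))) ^ (T s).dimO = 0 := hF _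
      rw [h0, vecMul_zero, zero_dotProduct, zero_add]

end SwitchedSystem

/-! ### Weighted least squares. -/

section Matrix

variable {ι κ : Type*} [Fintype ι] [DecidableEq ι] [Fintype κ] [DecidableEq κ]

-- Testing positivity on e_i ± e_j bounds an off-diagonal entry by the mean of two diagonal ones.
omit [DecidableEq ι] in
lemma Matrix.PosSemidef.abs_apply_le {P : Matrix ι ι ℝ} (hP : P.PosSemidef) {β : ℝ}
    (hβ : ∀ i, P i i ≤ β) (i j : ι) : |P i j| ≤ β := by
  classical
  have hsymm : P j i = P i j := by simpa using hP.1.apply i j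
  have h1 := hP.dotProduct_mulVec_nonneg (Pi.single i 1 + Pi.single j 1)
  have h2 := hP.dotProduct_mulVec_nonneg (Pi.single i 1 - Pi.single j 1)
  simp only [star_trivial, mulVec_add, mulVec_sub, dotProduct_add, add_dotProduct,
    dotProduct_sub, sub_dotProduct, mulVec_single_one, single_one_dotProduct, col_apply] at h1 h2
  rw [abs_le]
  constructor <;> linarith [hβ i, hβ j]

/-- The gain of the weighted least squares estimator. -/
def leastSquaresGain (Υ : Matrix ι ι ℝ) (W : Matrix ι κ ℝ) : Matrix κ ι ℝ :=
  (Wᵀ * Υ⁻¹ * W)⁻¹ * Wᵀ * Υ⁻¹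

variable {Υ : Matrix ι ι ℝ} {W : Matrix ι κ ℝ}

omit [DecidableEq κ] in
lemma posDef_transpose_mul_inv_mul (hΥ : Υ.PosDef) (hW : Function.Injective W.mulVec) :
    (Wᵀ * Υ⁻¹ * W).PosDef := by
  simpa using hΥ.inv.conjTranspose_mul_mul_same hW

lemma leastSquaresGain_mul (hΥ : Υ.PosDef) (hW : Function.Injective W.mulVec) :
    leastSquaresGain Υ W * W = 1 := by
  have h := (isUnit_iff_isUnit_det _).1 (posDef_transpose_mul_inv_mul hΥ hW).isUnit
  rw [leastSquaresGain, Matrix.mul_assoc, Matrix.mul_assoc, ← Matrix.mul_assoc Wᵀ,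
    nonsing_inv_mul _ h]

/-- **Gauss–Markov**: weighted least squares has minimal variance among linear unbiased
estimators. -/
lemma leastSquaresGain_variance_le (hΥ : Υ.PosDef) (hW : Function.Injective W.mulVec)
    {G : Matrix κ ι ℝ} (hG : G * W = 1) (a : κ) :
    (leastSquaresGain Υ W * Υ * (leastSquaresGain Υ W)ᵀ) a a ≤ (G * Υ * Gᵀ) a a := by
  set H := leastSquaresGain Υ W with hH
  have hU := (isUnit_iff_isUnit_det _).1 hΥ.isUnit
  have hΥt : Υᵀ = Υ := by
    rw [← conjTranspose_eq_transpose_of_trivial]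
    exact hΥ.1
  have hHΥ : H * Υ = (Wᵀ * Υ⁻¹ * W)⁻¹ * Wᵀ := by
    rw [hH, leastSquaresGain, nonsing_inv_mul_cancel_right _ _ hU]
  -- Orthogonality: H Υ ends in Wᵀ, while (G - H) W = 0 by unbiasedness. The variance of G then
  -- splits as in Pythagoras' theorem.
  have h0 : H * Υ * (G - H)ᵀ = 0 := by
    rw [hHΥ, Matrix.mul_assoc, ← transpose_mul, Matrix.sub_mul, hG,
      leastSquaresGain_mul hΥ hW, sub_self, transpose_zero, Matrix.mul_zero]
  have h0' : (G - H) * Υ * Hᵀ = 0 := by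
    have := congrArg transpose h0
    rwa [transpose_mul, transpose_mul, transpose_transpose, transpose_zero, hΥt,
      ← Matrix.mul_assoc] at this
  have hdecomp : G * Υ * Gᵀ = H * Υ * Hᵀ + (G - H) * Υ * (G - H)ᵀ := by
    have : G = H + (G - H) := by abel
    conv_lhs => rw [this]
    rw [transpose_add, Matrix.add_mul, Matrix.mul_add, Matrix.add_mul, Matrix.add_mul, h0, h0']
    abel
  have hpos := (hΥ.posSemidef.mul_mul_conjTranspose_same (G - H)).diag_nonneg (i := a)
  rw [conjTranspose_eq_transpose_of_trivial] at hpos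
  rw [hdecomp, Matrix.add_apply]
  linarith

omit [DecidableEq ι] [Fintype κ] [DecidableEq κ] in
lemma mul_mul_transpose_apply_le (G : Matrix κ ι ℝ) {β : ℝ} (hΥ : ∀ i j, |Υ i j| ≤ β) (a : κ) :
    (G * Υ * Gᵀ) a a ≤ ∑ j, ∑ i, |G a i| * β * |G a j| := by
  rw [Matrix.mul_apply]
  refine Finset.sum_le_sum fun j _ => ?_
  rw [Matrix.mul_apply, Finset.sum_mul]
  refine Finset.sum_le_sum fun i _ => (le_abs_self _).trans ?_
  rw [abs_mul, abs_mul, transpose_apply]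
  gcongr
  exact hΥ i j

end Matrix

/-! ### The fusion problem. -/

namespace SwitchedSystem

variable {l m n : ℕ} {S : SwitchedSystem l m n} [NeZero l] (T : S.Transforms)

lemma fusionW_mulVec (y : (Σ s : Fin m, Fin (T s).dimUo) ⊕ Fin n → ℝ) (s : Fin m) (a : Fin n) :
    (fusionW T *ᵥ y) (s, a) =
      y (.inr a) - ((T s).Tuo *ᵥ fun t => y (.inl ⟨s, t⟩)) a := by
  rw [fusionW, fromCols_mulVec, Pi.add_apply, add_comm, sub_eq_add_neg]
  congr 1
  · simp [mulVec, dotProduct, Matrix.one_apply]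
  · simp only [mulVec, dotProduct, Matrix.of_apply, Fintype.sum_sigma, Function.comp_apply]
    rw [Finset.sum_eq_single s]
    · simp
    · intro t _ hts
      simp [hts.symm]
    · simp

/-- For a kernel vector, the state part lies in the range of every `Tuo`, so no sensor observes it
and it vanishes. The remaining parts vanish because each `Tuo` has a left inverse. -/
lemma fusionW_injective (hobs : IsObservable (S.A 0) (S.C 0)) :
    Function.Injective (fusionW T).mulVec := by
  refine (injective_iff_map_eq_zero (fusionW T).mulVecLin).2 fun y hy => ?_
  have hy' (s : Fin m) : (fun a => y (.inr a)) = (T s).Tuo *ᵥ fun t => y (.inl ⟨s, t⟩) := by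
    ext a
    have := congrFun hy (s, a)
    rw [mulVecLin_apply, fusionW_mulVec, Pi.zero_apply] at this
    linarith
  have hx : (fun a => y (.inr a)) = 0 :=
    eq_zero_of_forall_mem_sensorUnobservable hobs fun s => by
      rw [hy' s]
      exact (T s).Tuo_mulVec_mem _
  have hz (s : Fin m) : (fun t => y (.inl ⟨s, t⟩)) = 0 := by
    rw [← one_mulVec (fun t => y (.inl ⟨s, t⟩)), ← (T s).toRows₁_mul_Tuo, ← mulVec_mulVec,
      ← hy' s, hx, mulVec_zero]
  ext (⟨s, t⟩ | a)
  · exact congrFun (hz s) t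
  · exact congrFun hx a

variable (mode : ℕ → Fin l)

section Error

variable {Ω : Type*} (x0 : Ω → EuclideanSpace ℝ (Fin n))
  (w : ℕ → Ω → EuclideanSpace ℝ (Fin n)) (v : ℕ → Ω → EuclideanSpace ℝ (Fin m))
  (α : ℕ → Fin m → Ω → EuclideanSpace ℝ (Fin n))

/-- The contribution of sensor `s` to the noise in the fusion problem. -/
def sensorFusionError (k : ℕ) (s : Fin m) (ω : Ω) : Fin n → ℝ :=
  (T s).To *ᵥ postError T mode x0 w v k s ω + (-1 : Matrix (Fin n) (Fin n) ℝ) *ᵥ (α k s ω).ofLp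

/-- The noise in the fusion problem. -/
def fusionError (k : ℕ) (ω : Ω) (sa : Fin m × Fin n) : ℝ :=
  sensorFusionError T mode x0 w v α k sa.1 ω sa.2

lemma fusedError_eq {σ : ℝ} {k : ℕ} (hΥ : (fusionCov T mode σ k).PosDef)
    (hW : Function.Injective (fusionW T).mulVec) (ω : Ω) (a : Fin n) :
    fusedError T mode x0 w v σ α k ω a =
      (leastSquaresGain (fusionCov T mode σ k) (fusionW T) *ᵥ
        fusionError T mode x0 w v α k ω) (.inr a) := by
  set x := S.state mode (x0 ω) (fun j => w j ω) k with hx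
  -- The true parameter: the state together with its unobservable coordinates for each sensor. The
  -- stacked estimates are W θ minus the fusion noise, and least squares recovers θ exactly from W
  -- θ.
  let θ : (Σ s : Fin m, Fin (T s).dimUo) ⊕ Fin n → ℝ :=
    Sum.elim (fun st => ((T st.1).Tinv.toRows₁ *ᵥ x) st.2) x
  have hy : stackedEst T mode (S.output mode (x0 ω) (fun j => w j ω) (fun j => v j ω))
      (fun j s => α j s ω) k = fusionW T *ᵥ θ - fusionError T mode x0 w v α k ω := by
    ext ⟨s, b⟩
    have hid := congrArg (fun M => (M *ᵥ x) b) (T s).Tuo_mul_add_To_mul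
    simp only [add_mulVec, one_mulVec, ← mulVec_mulVec, Pi.add_apply] at hid
    have hθ : (fusionW T *ᵥ θ) (s, b) = x b - ((T s).Tuo *ᵥ ((T s).Tinv.toRows₁ *ᵥ x)) b :=
      fusionW_mulVec T θ s b
    rw [Pi.sub_apply, hθ, fusionError, sensorFusionError, stackedEst, postError, ← hx]
    simp only [mulVec_sub, neg_mulVec, one_mulVec, Pi.add_apply, Pi.sub_apply, Pi.neg_apply]
    linarith
  have hfull : fusedFull T mode σ (S.output mode (x0 ω) (fun j => w j ω) (fun j => v j ω))
      (fun j s => α j s ω) k =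
        θ - leastSquaresGain (fusionCov T mode σ k) (fusionW T) *ᵥ
          fusionError T mode x0 w v α k ω := by
    change leastSquaresGain (fusionCov T mode σ k) (fusionW T) *ᵥ _ = _
    rw [hy, mulVec_sub, mulVec_mulVec, leastSquaresGain_mul hΥ hW, one_mulVec]
  rw [fusedError, Pi.sub_apply, fusedEst, hfull, Pi.sub_apply, ← hx]
  change x a - (x a - _) = _
  ring

end Error

section Moments

variable {σ : ℝ} {Ω : Type*} [MeasurableSpace Ω]
  {μ : Measure Ω} [IsProbabilityMeasure μ] {x0 : Ω → EuclideanSpace ℝ (Fin n)}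
  {w : ℕ → Ω → EuclideanSpace ℝ (Fin n)} {v : ℕ → Ω → EuclideanSpace ℝ (Fin m)}
  {α : ℕ → Fin m → Ω → EuclideanSpace ℝ (Fin n)}

omit [NeZero l] in
lemma IsNoise.secondMoment_artificial (h : S.IsNoise σ μ x0 w v α) (hσ : 0 ≤ σ) (k : ℕ) (s t : Fin m) :
    secondMoment μ (fun ω => (α k s ω).ofLp) (fun ω => (α k t ω).ofLp) =
      if s = t then σ • 1 else 0 := by
  split_ifs with hst
  · subst hst
    simpa using secondMoment_of_hasLaw_multivariateGaussian (PosSemidef.one.smul hσ)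
      (h.artificial k s)
  · refine (h.centered_artificial k s).uncorr (.artificial k t) fun hts => hst ?_
    simpa using hts.symm

variable (h : S.IsNoise σ μ x0 w v α)
  (hnull : ∀ s i j, S.sensorUnobservable i s = S.sensorUnobservable j s)
include h hnull

lemma fusionError_isL2 (k : ℕ) : IsL2Vec μ (fusionError T mode x0 w v α k) := fun sa =>
  ((centeredUncorr_postError T mode h hnull k sa.1).isL2.mulVec _).add
    ((h.centered_artificial k sa.1).isL2.mulVec _) sa.2

lemma integral_fusionError (k : ℕ) (sa : Fin m × Fin n) :
    ∫ ω, fusionError T mode x0 w v α k ω sa ∂μ = 0 :=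
  (((((centeredUncorr_postError T mode h hnull k sa.1).mulVec h.isL2 (T sa.1).To).mono
    (Set.subset_univ _)).add h.isL2 (((h.centered_artificial k sa.1).mulVec h.isL2 (-1)).mono
      (Set.subset_univ _)))).mean sa.2

lemma secondMoment_fusionError (hQ : S.Q.PosSemidef) (hR : S.R.PosSemidef)
    (hP0 : S.P0.PosSemidef) (hσ : 0 ≤ σ) (k : ℕ) :
    secondMoment μ (fusionError T mode x0 w v α k) (fusionError T mode x0 w v α k) =
      fusionCov T mode σ k := by
  ext ⟨s, a⟩ ⟨t, b⟩
  have hc := centeredUncorr_postError T mode h hnull k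
  have hα (s : Fin m) : NoiseIndex.artificial k s ∉ pastNoise m k (k + 1) := fun hk => hk
  have key := secondMoment_mulVec_add_mulVec (hc s).isL2 (h.centered_artificial k s).isL2
    (hc t).isL2 (h.centered_artificial k t).isL2 ((hc s).uncorr _ (hα t)) ((hc t).uncorr _ (hα s))
    (T s).To (-1) (T t).To (-1)
  rw [secondMoment_postError T mode h hnull hQ hR hP0, h.secondMoment_artificial hσ] at key
  refine (congrFun (congrFun key a) b).trans ?_
  rw [fusionCov, Matrix.add_apply, Matrix.add_apply]
  congr 1
  by_cases hst : s = t <;> simp [hst, Matrix.one_apply]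

/-- The first summand is the second moment of the lifted filter errors and may be singular; σ I
makes the sum definite. -/
lemma fusionCov_posDef (hQ : S.Q.PosSemidef) (hR : S.R.PosSemidef)
    (hP0 : S.P0.PosSemidef) (hσ : 0 < σ) (k : ℕ) : (fusionCov T mode σ k).PosDef := by
  have hc := centeredUncorr_postError T mode h hnull k
  let X (ω : Ω) (sa : Fin m × Fin n) : ℝ := ((T sa.1).To *ᵥ postError T mode x0 w v k sa.1 ω) sa.2
  have hX : IsL2Vec μ X := fun sa => (hc sa.1).isL2.mulVec (T sa.1).To sa.2
  refine PosDef.posSemidef_add ?_ (PosDef.one.smul hσ)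
  convert secondMoment_self_posSemidef hX using 1
  ext ⟨s, a⟩ ⟨t, b⟩
  rw [Matrix.of_apply, ← secondMoment_postError T mode h hnull hQ hR hP0,
    ← secondMoment_mulVec_left (hc s).isL2 (hc t).isL2,
    ← secondMoment_mulVec_right ((hc s).isL2.mulVec _) (hc t).isL2]
  rfl

end Moments

/-- A diagonal entry is the a posteriori quadratic form at a row of `To`, plus σ. -/
lemma exists_fusionCov_le (hR : S.R.PosDef)
    (hnull : ∀ s i j, S.sensorUnobservable i s = S.sensorUnobservable j s)
    {κ : ℕ} (hκ : n ≤ κ) (σ : ℝ) :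
    ∃ β : ℝ, ∀ mode : ℕ → Fin l, (∀ j k, j / κ = k / κ → mode j = mode k) →
      (∀ k s, (priorCov T mode k s s).PosSemidef) →
      ∀ k sa, fusionCov T mode σ k sa sa ≤ β := by
  choose N hN using fun sa : Fin m × Fin n =>
    exists_priorCov_le (T := T) hR hnull hκ sa.1 ((T sa.1).To sa.2)
  obtain ⟨β, hβ⟩ := (Set.finite_range N).bddAbove
  refine ⟨β + σ, fun mode hmode hP k sa => ?_⟩
  have h1 := (dotProduct_postCov_le_priorCov hR (hP k sa.1) ((T sa.1).To sa.2)).trans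
    ((hN sa mode hmode (fun k => hP k sa.1) k).trans (hβ ⟨sa, rfl⟩))
  have h2 : ((T sa.1).To * postCov T mode k sa.1 sa.1 * (T sa.1).Toᵀ) sa.2 sa.2 =
      (T sa.1).To sa.2 ⬝ᵥ (postCov T mode k sa.1 sa.1 *ᵥ (T sa.1).To sa.2) := by
    rw [dotProduct_mulVec]
    rfl
  rw [fusionCov, Matrix.add_apply, Matrix.of_apply, h2]
  simpa using h1

end SwitchedSystem

end

theorem theorem4 {l m n : ℕ} [NeZero l] (S : SwitchedSystem l m n)
    (hQ : S.Q.PosSemidef) (hR : S.R.PosDef) (hP0 : S.P0.PosSemidef)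
    (hobs : ∀ i, IsObservable (S.A i) (S.C i))
    (hnull : ∀ s i j, S.sensorUnobservable i s = S.sensorUnobservable j s)
    (T : S.Transforms) (κ : ℕ) (hκ : 2 * n ≤ κ) (σ : ℝ) (hσ : 0 < σ)
    {Ω : Type*} [MeasurableSpace Ω] (μ : Measure Ω) [IsProbabilityMeasure μ]
    (x0 : Ω → EuclideanSpace ℝ (Fin n)) (w : ℕ → Ω → EuclideanSpace ℝ (Fin n))
    (v : ℕ → Ω → EuclideanSpace ℝ (Fin m)) (α : ℕ → Fin m → Ω → EuclideanSpace ℝ (Fin n))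
    (hnoise : S.IsNoise σ μ x0 w v α) :
    ∃ M : ℝ, ∀ mode : ℕ → Fin l, (∀ j k, j / κ = k / κ → mode j = mode k) → ∀ k : ℕ,
      -- every inverse in the definition of the estimator is a genuine inverse
      (∀ s, 0 < SwitchedSystem.innovationVar T (mode k) s
        (SwitchedSystem.priorCov T mode k s s)) ∧
      (SwitchedSystem.fusionCov T mode σ k).PosDef ∧
      IsUnit ((SwitchedSystem.fusionW T)ᵀ * (SwitchedSystem.fusionCov T mode σ k)⁻¹ *
        SwitchedSystem.fusionW T) ∧
      -- the matrices propagated by the filters are the joint error covariances of the filters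
      (∀ s₁ s₂ a b,
        Integrable (fun ω => SwitchedSystem.priorError T mode x0 w v k s₁ ω a *
          SwitchedSystem.priorError T mode x0 w v k s₂ ω b) μ ∧
        ∫ ω, SwitchedSystem.priorError T mode x0 w v k s₁ ω a *
          SwitchedSystem.priorError T mode x0 w v k s₂ ω b ∂μ =
            SwitchedSystem.priorCov T mode k s₁ s₂ a b) ∧
      (∀ s₁ s₂ a b,
        Integrable (fun ω => SwitchedSystem.postError T mode x0 w v k s₁ ω a *
          SwitchedSystem.postError T mode x0 w v k s₂ ω b) μ ∧
        ∫ ω, SwitchedSystem.postError T mode x0 w v k s₁ ω a *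
          SwitchedSystem.postError T mode x0 w v k s₂ ω b ∂μ =
            SwitchedSystem.postCov T mode k s₁ s₂ a b) ∧
      -- the fused estimator is unbiased and its error covariance is bounded by `M`
      (∀ a, MemLp (fun ω => SwitchedSystem.fusedError T mode x0 w v σ α k ω a) 2 μ ∧
        ∫ ω, SwitchedSystem.fusedError T mode x0 w v σ α k ω a ∂μ = 0) ∧
      ∀ a b, |cov[fun ω => SwitchedSystem.fusedError T mode x0 w v σ α k ω a,
        fun ω => SwitchedSystem.fusedError T mode x0 w v σ α k ω b; μ]| ≤ M := by
  open SwitchedSystem in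
  have hW := fusionW_injective T (hobs 0)
  -- The competitor for Gauss–Markov: unweighted least squares, one fixed gain for all k and all
  -- mode sequences.
  set G := leastSquaresGain 1 (fusionW T)
  have hG : G * fusionW T = 1 := leastSquaresGain_mul .one hW
  obtain ⟨β, hβ⟩ := exists_fusionCov_le T hR hnull (by omega : n ≤ κ) σ
  let B (a : Fin n) : ℝ := ∑ j, ∑ i, |G (.inr a) i| * β * |G (.inr a) j|
  obtain ⟨M, hM⟩ := (Set.finite_range B).bddAbove
  refine ⟨M, fun mode hmode k => ?_⟩
  have hRs := hR.posSemidef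
  have hP (k s) := priorCov_posSemidef T mode hnoise hnull hQ hRs hP0 k s
  have hΥ := fusionCov_posDef T mode hnoise hnull hQ hRs hP0 hσ k
  have hz := fusionError_isL2 T mode hnoise hnull k
  have hprior := centeredUncorr_priorError T mode hnoise hnull k
  have hpost := centeredUncorr_postError T mode hnoise hnull k
  set H := leastSquaresGain (fusionCov T mode σ k) (fusionW T) with hH
  have herr (a : Fin n) : (fun ω => fusedError T mode x0 w v σ α k ω a) =
      fun ω => (H *ᵥ fusionError T mode x0 w v α k ω) (.inr a) :=
    funext fun ω => fusedError_eq T mode x0 w v α hΥ hW ω a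
  have hmean (a : Fin n) : ∫ ω, fusedError T mode x0 w v σ α k ω a ∂μ = 0 := by
    rw [herr]
    simp only [mulVec, dotProduct]
    rw [integral_finsetSum _ fun c _ => ((hz c).integrable one_le_two).const_mul _]
    simp [integral_const_mul, integral_fusionError T mode hnoise hnull]
  refine ⟨fun s => ?_, hΥ, (posDef_transpose_mul_inv_mul hΥ hW).isUnit, fun s₁ s₂ a b => ⟨?_, ?_⟩,
    fun s₁ s₂ a b => ⟨?_, ?_⟩, fun a => ⟨?_, hmean a⟩, fun a b => ?_⟩
  · have := (hP k s).dotProduct_mulVec_nonneg (subC T (mode k) s)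
    rw [star_trivial] at this
    exact add_pos_of_nonneg_of_pos this hR.diag_pos
  · exact (hprior s₁).isL2.integrable_mul (hprior s₂).isL2 a b
  · rw [← secondMoment_priorError T mode hnoise hnull hQ hRs hP0]
    rfl
  · exact (hpost s₁).isL2.integrable_mul (hpost s₂).isL2 a b
  · rw [← secondMoment_postError T mode hnoise hnull hQ hRs hP0]
    rfl
  · rw [herr]
    exact hz.mulVec H (.inr a)
  · have hcov : cov[fun ω => fusedError T mode x0 w v σ α k ω a,
        fun ω => fusedError T mode x0 w v σ α k ω b; μ] =
          ((H * fusionCov T mode σ k * Hᵀ).submatrix Sum.inr Sum.inr) a b := by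
      rw [← secondMoment_fusionError T mode hnoise hnull hQ hRs hP0 hσ.le,
        ← secondMoment_mulVec_left hz hz, ← secondMoment_mulVec_right (hz.mulVec H) hz,
        covariance, hmean, hmean]
      simp only [sub_zero, fusedError_eq T mode x0 w v α hΥ hW]
      rfl
    rw [hcov]
    -- The error covariance is a principal submatrix of H Υ Hᵀ, so bounding its diagonal suffices.
    refine PosSemidef.abs_apply_le (PosSemidef.submatrix ?_ _) (fun c => ?_) a b
    · simpa using hΥ.posSemidef.mul_mul_conjTranspose_same H
    · exact (leastSquaresGain_variance_le hΥ hW hG _).trans ((mul_mul_transpose_apply_le G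
        (hΥ.posSemidef.abs_apply_le (hβ mode hmode hP k)) _).trans (hM ⟨c, rfl⟩))
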